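/- **Setting.** Let $n\ge 1$ and let $(\overline M,g)$ be a smooth compact $n$-dimensional Riemannian manifold with smooth (possibly empty) boundary $\partial M$, interior $M$, Riemannian distance $d$ ($d=\infty$ between different components, $d(\cdot,\emptyset)=\infty$) and Riemannian volume measure $dy$. Let $\varepsilon>0$ and let $\chi:\mathbb R\to[0,1]$ be a smooth cut-off function with $\chi(s)=1$ for $s<1$ and $\chi(s)=0$ for $s>2$. For $s\in[0,\infty)$ put $h(s)=s\,\chi(s/\varepsilon)+2\varepsilon\,(1-\chi(s/\varepsilon))$, put $h(\infty)=2\varepsilon$, and let $\rho(x,y)=h(d(x,y))$ be the smoothed distance of $\overline M$. Let $(\widetilde M,\bar g)$ be a smooth $n$-dimensional Riemannian manifold without boundary, with distance $\bar d$, that contains $\overline M$ as a smoothly embedded submanifold with $\bar g|_{\overline M}=g$. Let $\bar\rho:\widetilde M\times\widetilde M\to\mathbb R$ be an extension of the smoothed distance to $\widetilde M$, in the following sense: $\bar\rho=\rho$ on $\overline M\times\overline M$; for each $p\in\widetilde M\setminus\overline M$ the function $\bar\rho(p,\cdot)$ is continuous on $\overline M$; and there is $c>0$ with $\bar\rho(p,y)\ge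 c\,h(\bar d(p,y))$ for all $p\in\widetilde M\setminus\overline M$, $y\in\overline M$. Put $\bar\rho(p,\partial M)=\inf_{q\in\partial M}\bar\rho(p,q)$. For each $x\in\overline M$ with $d(x,\partial M)<2\varepsilon$ let $x^*\in\widetilde M\setminus M$ be a reflected point: $\bar\rho(x^*,\partial M)=\bar\rho(x,\partial M)$, and $x$ and $x^*$ have the same nearest neighbours on $\partial M$ (for the distances $d$ and $\bar d$, respectively). Let $K_\alpha$ be the modified Bessel function of the second kind, that is, $K_\alpha(z)=\frac{\pi}{2}\,\frac{I_{-\alpha}(z)-I_\alpha(z)}{\sin(\pi\alpha)}$ for $\alpha\in\mathbb R\setminus\mathbb Z$, with $I_\alpha(z)=\sum_{k\ge0}\frac{(z/2)^{2k+\alpha}}{\Gamma(k+\alpha+1)\,k!}$, and $K_\alpha(z)=\lim_{\beta\to\alpha,\ \beta\ne\alpha}K_\beta(z)$ for $\alpha\in\mathbb Z$. For $\lambda\in\mathbb C\setminus(-\infty,0]$ and $r>0$ put (with principal powers) $$k_\lambda(r)=\frac{\sqrt\lambda^{\,n/2-1}}{\sqrt{2\pi}^{\,n}}\,\frac{K_{n/2-1}(\sqrt\lambda\,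 r)}{r^{\,n/2-1}},$$ and for $x,y\in\overline M$, $x\neq y$, define $$K_\lambda(x,y)=\begin{cases}k_\lambda(\bar\rho(x,y))-k_\lambda(\bar\rho(x^*,y)),& d(x,\partial M)<\varepsilon,\\ k_\lambda(\bar\rho(x,y))-\chi\!\left(\bar\rho(x,\partial M)/\varepsilon\right)k_\lambda(\bar\rho(x^*,y)),& d(x,\partial M)\in[\varepsilon,2\varepsilon],\\ k_\lambda(\bar\rho(x,y)),& d(x,\partial M)>2\varepsilon\end{cases}$$ (if $d(x,\partial M)=2\varepsilon$, the factor $\chi(\bar\rho(x,\partial M)/\varepsilon)$ is $0$ and the second term is absent). Finally put $(G_\lambda f)(x)=\int_M K_\lambda(x,y)f(y)\,dy$, and $\Sigma_\theta=\{z\in\mathbb C\setminus\{0\}:|\arg z|<\theta\}$. **Proposition 2.2.** Let $\eta>0$. There is a constant $C(\eta)>0$ (which may also depend on the fixed data $\overline M,g,\varepsilon,\chi,\widetilde M,\bar g,\bar\rho$ and the choice of the points $x^*$, but not on $\lambda$ and $f$) such that for all $\lambda\in\Sigma_{\pi-\eta}$ with $|\lambda|\ge1$ and all $f\in C(\overline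 M)$ (complex-valued) the integral defining $(G_\lambda f)(x)$ converges absolutely for every $x\in\overline M$, and $$\|G_\lambda f\|_\infty\le\frac{C(\eta)}{|\lambda|}\,\|f\|_\infty,$$ both for the supremum norms over $\overline M$ and for the essential supremum norms with respect to the volume measure. -/

import Mathlib

open Set Filter MeasureTheory Manifold Bundle Topology
open scoped ENNReal ContDiff

noncomputable section

/-! ### Sectors and modified Bessel functions -/

/-- The sector `Σ_θ = {z ∈ ℂ ∖ {0} : |arg z| < θ}`. -/
def sector (θ : ℝ) : Set ℂ := {z : ℂ | z ≠ 0 ∧ |z.arg| < θ}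

/-- The modified Bessel function of the first kind
`I_α(z) = ∑ₖ (z/2)^(2k+α) / (Γ(k+α+1) k!)` (principal branch of the powers). `Complex.Gamma` is `0`
at its poles, so that `1/Γ` vanishes there, as it should. -/
def besselI (α : ℝ) (z : ℂ) : ℂ :=
  ∑' k : ℕ, (z / 2) ^ (2 * (k : ℂ) + (α : ℂ)) /
    (Complex.Gamma ((k : ℂ) + (α : ℂ) + 1) * (Nat.factorial k : ℂ))

/-- The quotient that defines the modified Bessel function of the second kind of order `α ∉ ℤ`. -/
def besselKAux (α : ℝ) (z : ℂ) : ℂ :=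
  (Real.pi / 2 : ℂ) * ((besselI (-α) z - besselI α z) / (Real.sin (Real.pi * α) : ℂ))

open Classical in
/-- The modified Bessel function of the second kind `K_α`, `α ∈ ℝ`: the quotient
`π/2 · (I_{-α} - I_α) / sin(πα)` for `α ∉ ℤ`, and the limit of these as the order tends to `α`
if `α ∈ ℤ`. -/
def besselK (α : ℝ) (z : ℂ) : ℂ :=
  if ∃ m : ℤ, (m : ℝ) = α then limUnder (𝓝[≠] α) (fun a : ℝ => besselKAux a z)
  else besselKAux α z

/-- The function `√λ^(n/2-1) / √(2π)^n · K_{n/2-1}(√λ r) / r^(n/2-1)` of the radius `r`. -/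
def radialKernel (n : ℕ) (lam : ℂ) (r : ℝ) : ℂ :=
  (lam ^ (1 / 2 : ℂ)) ^ (((n : ℝ) / 2 - 1 : ℝ) : ℂ) / ((Real.sqrt (2 * Real.pi) ^ n : ℝ) : ℂ) *
    (besselK ((n : ℝ) / 2 - 1) (lam ^ (1 / 2 : ℂ) * (r : ℂ)) /
      ((r ^ ((n : ℝ) / 2 - 1) : ℝ) : ℂ))

/-! ### The smoothed distance -/

/-- A smooth cut-off function: `χ = 1` on `(-∞, 1)`, `χ = 0` on `(2, ∞)`, values in `[0, 1]`. -/
structure IsCutoff (χ : ℝ → ℝ) : Prop where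
  contDiff : ContDiff ℝ ∞ χ
  mem_Icc : ∀ s, χ s ∈ Icc (0 : ℝ) 1
  eq_one : ∀ s, s < 1 → χ s = 1
  eq_zero : ∀ s, 2 < s → χ s = 0

/-- `s χ(s/ε) + 2ε (1 - χ(s/ε))` for a distance `s ∈ [0, ∞]`; the value at `s = ∞` (points in
different components) is `2ε`, as for all large `s`. -/
def smoothedDist (ε : ℝ) (χ : ℝ → ℝ) (s : ℝ≥0∞) : ℝ :=
  if s = (⊤ : ℝ≥0∞) then 2 * ε
  else s.toReal * χ (s.toReal / ε) + 2 * ε * (1 - χ (s.toReal / ε))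

/-! ### The Riemannian volume measure -/

section Volume

variable {n : ℕ} [NeZero n]
  (M : Type*) [EMetricSpace M] [ChartedSpace (EuclideanHalfSpace n) M]
  [RiemannianBundle (fun x : M => TangentSpace (𝓡∂ n) x)]

variable {M} in
/-- The `i`-th coordinate vector field `∂ᵢ` of the chart around `c`, at the point with
coordinates `u`. -/
def coordVec (c : M) (u : EuclideanSpace ℝ (Fin n)) (i : Fin n) :
    TangentSpace (𝓡∂ n) ((extChartAt (𝓡∂ n) c).symm u) :=
  mfderivWithin 𝓘(ℝ, EuclideanSpace ℝ (Fin n)) (𝓡∂ n) (extChartAt (𝓡∂ n) c).symm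
    (range (𝓡∂ n)) u (EuclideanSpace.single i (1 : ℝ))

variable {M} in
/-- The volume density `√det (g_ij)` in the chart around `c`, with `g_ij = g(∂ᵢ, ∂ⱼ)`. -/
def volumeDensity (c : M) (u : EuclideanSpace ℝ (Fin n)) : ℝ :=
  Real.sqrt (Matrix.of fun i j : Fin n => inner ℝ (coordVec c u i) (coordVec c u j)).det

variable {M} in
/-- The measure `√det (g_ij) du` on the domain of the chart around `c`. -/
def chartVolume [MeasurableSpace M] (c : M) : Measure M :=
  Measure.map (extChartAt (𝓡∂ n) c).symm
    ((volume.restrict (extChartAt (𝓡∂ n) c).target).withDensity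
      fun u => ENNReal.ofReal (volumeDensity c u))

variable (n) in
/-- The Riemannian volume measure of `M`, glued from the measures `√det (g_ij) du` in the charts by
a smooth partition of unity `(f_c)` that is subordinate to the charts:
`dvol = ∑_c f_c √det (g_ij) du`. (By the change of variables formula, the measure does not depend
on the partition of unity.) -/
def riemannianVolume [IsManifold (𝓡∂ n) ∞ M] [CompactSpace M] [MeasurableSpace M] : Measure M :=
  Measure.sum fun c : M => (chartVolume (n := n) c).withDensity fun y => ENNReal.ofReal
    ((SmoothPartitionOfUnity.exists_isSubordinate_chartAt_source (𝓡∂ n) M).choose c y)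

end Volume

/-! ### The extended manifold, the extended smoothed distance, and the reflection -/

section Extension

variable {n : ℕ} [NeZero n]
  {M : Type*} [EMetricSpace M] [ChartedSpace (EuclideanHalfSpace n) M]
  {N : Type*} [EMetricSpace N]

/-- The Riemannian manifold `N` (of the same dimension, without boundary) extends the Riemannian
manifold `M` with boundary: `ι` is a smooth embedding and pulls the metric of `N` back to the
metric of `M`. -/
structure IsRiemannianExtension
    [RiemannianBundle (fun x : M => TangentSpace (𝓡∂ n) x)]
    [ChartedSpace (EuclideanSpace ℝ (Fin n)) N]
    [RiemannianBundle (fun x : N => TangentSpace (𝓡 n) x)]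
    (ι : M → N) : Prop where
  contMDiff : ContMDiff (𝓡∂ n) (𝓡 n) ∞ ι
  isEmbedding : IsEmbedding ι
  inner_eq : ∀ (x : M) (v w : TangentSpace (𝓡∂ n) x),
    inner ℝ (mfderiv (𝓡∂ n) (𝓡 n) ι x v) (mfderiv (𝓡∂ n) (𝓡 n) ι x w) = inner ℝ v w

/-- `ρ'` extends the smoothed distance `ρ` of `M` to `N`: it is equal to `ρ` on `M × M`, and for
`p ∈ N ∖ M` the function `ρ'(p, ·)` is continuous on `M` and bounded below by a positive multiple
of the smoothed distance of `N`. -/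
structure IsSmoothedDistExtension (ε : ℝ) (χ : ℝ → ℝ) (ι : M → N) (ρ' : N → N → ℝ) : Prop where
  extends_rho : ∀ x y : M, ρ' (ι x) (ι y) = smoothedDist ε χ (edist x y)
  continuous_right : ∀ p ∉ range ι, Continuous fun y : M => ρ' p (ι y)
  comparable : ∃ c > 0, ∀ p ∉ range ι, ∀ y : M,
    c * smoothedDist ε χ (edist p (ι y)) ≤ ρ' p (ι y)

variable (n M) in
/-- The boundary `∂M`. -/
abbrev bdry : Set M := (𝓡∂ n).boundary M

variable (n) in
/-- `ρ'(p, ∂M) = inf {ρ'(p, q) : q ∈ ∂M}` for `p ∈ N`. -/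
def rhoBdry (ι : M → N) (ρ' : N → N → ℝ) (p : N) : ℝ := ⨅ q : bdry n M, ρ' p (ι q)

variable (n) in
/-- `x ↦ x* = σ x` is the reflection at `∂M`: if `d(x, ∂M) < 2ε`, then `x*` is not an interior
point of `M`, `ρ'(x, ∂M) = ρ'(x*, ∂M)`, and `x` and `x*` have the same nearest neighbours
on `∂M`. -/
structure IsReflection (ε : ℝ) (ι : M → N) (ρ' : N → N → ℝ) (σ : M → N) : Prop where
  notMem_interior : ∀ x : M, Metric.infEDist x (bdry n M) < ENNReal.ofReal (2 * ε) →
    σ x ∉ ι '' (𝓡∂ n).interior M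
  rhoBdry_eq : ∀ x : M, Metric.infEDist x (bdry n M) < ENNReal.ofReal (2 * ε) →
    rhoBdry n ι ρ' (ι x) = rhoBdry n ι ρ' (σ x)
  nearest_iff : ∀ x : M, Metric.infEDist x (bdry n M) < ENNReal.ofReal (2 * ε) →
    ∀ p ∈ bdry n M, (∀ q ∈ bdry n M, edist x p ≤ edist x q) ↔
      (∀ q ∈ bdry n M, edist (σ x) (ι p) ≤ edist (σ x) (ι q))

open Classical in
variable (n) in
/-- The kernel `K_λ(x, y)`. In the second case the value of `σ x` at points with
`d(x, ∂M) = 2ε` is irrelevant, as the factor `χ(ρ'(x, ∂M)/ε)` vanishes there. -/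
def greenKernel (ε : ℝ) (χ : ℝ → ℝ) (ι : M → N) (ρ' : N → N → ℝ) (σ : M → N)
    (lam : ℂ) (x y : M) : ℂ :=
  if Metric.infEDist x (bdry n M) < ENNReal.ofReal ε then
    radialKernel n lam (ρ' (ι x) (ι y)) - radialKernel n lam (ρ' (σ x) (ι y))
  else if Metric.infEDist x (bdry n M) ≤ ENNReal.ofReal (2 * ε) then
    radialKernel n lam (ρ' (ι x) (ι y)) -
      (χ (rhoBdry n ι ρ' (ι x) / ε) : ℂ) * radialKernel n lam (ρ' (σ x) (ι y))
  else radialKernel n lam (ρ' (ι x) (ι y))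

variable (n) in
/-- The integral operator `(G_λ f)(x) = ∫_M K_λ(x, y) f(y) dy`. -/
def greenOp [RiemannianBundle (fun x : M => TangentSpace (𝓡∂ n) x)]
    [IsManifold (𝓡∂ n) ∞ M] [CompactSpace M] [MeasurableSpace M]
    (ε : ℝ) (χ : ℝ → ℝ) (ι : M → N) (ρ' : N → N → ℝ) (σ : M → N)
    (lam : ℂ) (f : M → ℂ) (x : M) : ℂ :=
  ∫ y, greenKernel n ε χ ι ρ' σ lam x y * f y ∂(riemannianVolume n M)

end Extension

end

/-! The claim is an L¹ bound for the kernel in `y`, uniform in `x`: `∫ |k_λ(ρ'(p, y))| dy ≤ C / |λ|`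
for every `p ∈ N` (`exists_lintegral_radialKernel_le`). Applied to `p = ι x` and `p = σ x`, it
bounds `G_λ` in both norms.

With `s = |λ|^(1/2)`, the radial kernel is at most `C s^(n-2) g(s r)`, where `g(t) = min
(t^(-(n-1/2)), t^(-(n+1/2)))` (`exists_norm_radialKernel_le`): integrable at `0` and at infinity in
dimension `n`. If balls of radius `r` have volume at most `A r^n`, a dyadic sum gives `∫ g(s d) ≤ A'
s^(-n)` (`exists_lintegral_radialProfile_le`), and `s^(n-2) s^(-n) = 1 / |λ|`. Since `ρ'` dominates
a multiple of `min (d, 2ε)`, the remaining region is one where `ρ'` is bounded below; there `g(t) ≤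
t^(-n)` and finite volume give the same power of `s`.

Two inputs need work. The volume growth must be uniform over centres `p ∈ N`, which may lie outside
`M`; it holds because on compact sets chart distances in `M` are bounded by distances of the images
in `N` (`exists_riemannianVolume_ball_le`). The kernel bound needs `K_ν(z) = 1/2 ∫ exp (ν t - z cosh
t) dt` for `Re z > 0` (`besselK_eq_besselKInt`). For `0 < ν < 1` and real `z`, the series and the
integral solve the same singular linear system with the same limit at `0`; the identity theorem, the
recurrence in the order and continuity in the order do the rest. -/

/-! ### Riemannian distances under maps and in charts. -/

section Riemannian

open scoped NNReal

variable
  {E : Type*} [NormedAddCommGroup E] [NormedSpace ℝ E]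
  {H : Type*} [TopologicalSpace H] {I : ModelWithCorners ℝ E H}
  {M : Type*} [PseudoEMetricSpace M] [ChartedSpace H M]
  [RiemannianBundle (fun x : M => TangentSpace I x)]
  [IsRiemannianManifold I M]
  {E' : Type*} [NormedAddCommGroup E'] [NormedSpace ℝ E']
  {H' : Type*} [TopologicalSpace H'] {I' : ModelWithCorners ℝ E' H'}
  {N : Type*} [PseudoEMetricSpace N] [ChartedSpace H' N]
  [RiemannianBundle (fun x : N => TangentSpace I' x)]
  [IsRiemannianManifold I' N]

variable (I I') in
/-- A `C^1` map whose differential does not increase norms does not increase distances. -/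
lemma edist_map_le_of_enorm_mfderiv_le {f : M → N} (hf : ContMDiff I I' 1 f)
    (h : ∀ (x : M) (v : TangentSpace I x), ‖mfderiv I I' f x v‖ₑ ≤ ‖v‖ₑ) (x y : M) :
    edist (f x) (f y) ≤ edist x y := by
  rw [IsRiemannianManifold.out (I := I) x y, IsRiemannianManifold.out (I := I') (f x) (f y)]
  refine le_of_forall_gt fun r hr => ?_
  obtain ⟨γ, h0, h1, hγ, hlen⟩ := exists_lt_of_riemannianEDist_lt hr
  refine lt_of_le_of_lt (riemannianEDist_le_pathELength (γ := f ∘ γ) (a := 0) (b := 1)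
    (hf.comp_contMDiffOn hγ) (by simp [h0]) (by simp [h1]) zero_le_one) (lt_of_le_of_lt ?_ hlen)
  rw [pathELength_eq_lintegral_mfderivWithin_Icc, pathELength_eq_lintegral_mfderivWithin_Icc]
  refine setLIntegral_mono' measurableSet_Icc fun t ht => ?_
  have hd : mfderivWithin 𝓘(ℝ, ℝ) I' (f ∘ γ) (Icc 0 1) t =
      (mfderiv I I' f (γ t)).comp (mfderivWithin 𝓘(ℝ, ℝ) I γ (Icc 0 1) t) := by
    apply mfderiv_comp_mfderivWithin
    · exact (hf.mdifferentiable one_ne_zero) _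
    · exact hγ.mdifferentiableOn one_ne_zero _ ht
    · rw [uniqueMDiffWithinAt_iff_uniqueDiffWithinAt]
      exact uniqueDiffOn_Icc zero_lt_one _ ht
  rw [hd]
  exact h _ _

variable (I) in
/-- Locally, the distance in a chart is bounded by the Riemannian distance. -/
lemma exists_nhds_edist_extChartAt_le [IsManifold I 1 M]
    [IsContinuousRiemannianBundle E (fun x : M => TangentSpace I x)] (q : M) :
    ∃ C : ℝ≥0, ∃ U ∈ 𝓝 q, ∀ y ∈ U, ∀ y' ∈ U,
      edist (extChartAt I q y) (extChartAt I q y') ≤ C * edist y y' := by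
  obtain ⟨C, C_pos, hC⟩ := eventually_enorm_mfderiv_extChartAt_lt I q
  obtain ⟨r, r_pos, hr⟩ := Metric.nhds_basis_eball.mem_iff.1
    (Filter.inter_mem hC (chart_source_mem_nhds H q))
  -- A path of length below `2r/3` that starts in the ball of radius `r/3` stays in the ball of
  -- radius `r`, where the chart and its derivative bound are available.
  have r3 : 0 < r / 3 := ENNReal.div_pos r_pos.ne' (by simp)
  refine ⟨C, Metric.eball q (r / 3), Metric.eball_mem_nhds q r3, fun y hy y' hy' => ?_⟩
  rw [IsRiemannianManifold.out (I := I) y y']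
  have hyy' : edist y y' < r / 3 + r / 3 := by
    refine (edist_triangle_right y y' q).trans_lt (ENNReal.add_lt_add hy hy')
  have key : ∀ L, riemannianEDist I y y' < L → L ≤ r / 3 + r / 3 →
      edist (extChartAt I q y) (extChartAt I q y') ≤ C * L := by
    intro L hL hL3
    obtain ⟨γ, h0, h1, hγ, hlen⟩ := exists_lt_of_riemannianEDist_lt hL
    have hin : ∀ t ∈ Icc (0 : ℝ) 1, γ t ∈ Metric.eball q r := by
      intro t ht
      have h2 : edist y (γ t) < r / 3 + r / 3 := by
        rw [IsRiemannianManifold.out (I := I) y]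
        refine lt_of_le_of_lt (riemannianEDist_le_pathELength (γ := γ) (a := 0) (b := t)
          (hγ.mono (Icc_subset_Icc_right ht.2)) h0 rfl ht.1) ?_
        exact ((pathELength_mono le_rfl ht.2).trans_lt hlen).trans_le hL3
      rw [Metric.mem_eball, edist_comm]
      calc edist q (γ t) ≤ edist q y + edist y (γ t) := edist_triangle _ _ _
        _ < r / 3 + (r / 3 + r / 3) := by
          rw [edist_comm q y]
          exact ENNReal.add_lt_add hy h2
        _ = r := by rw [← add_assoc, ENNReal.add_thirds]
    have hsrc : ∀ t ∈ Icc (0 : ℝ) 1, γ t ∈ (chartAt H q).source := fun t ht => (hr (hin t ht)).2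
    let γ' := extChartAt I q ∘ γ
    have hγ' : ContMDiffOn 𝓘(ℝ, ℝ) 𝓘(ℝ, E) 1 γ' (Icc 0 1) :=
      contMDiffOn_extChartAt.comp (I' := I) (t := (chartAt H q).source) hγ hsrc
    calc edist (extChartAt I q y) (extChartAt I q y') = ‖γ' 1 - γ' 0‖ₑ := by
          rw [edist_comm, edist_eq_enorm_sub]; simp [γ', h0, h1]
      _ ≤ ∫⁻ t in Icc 0 1, ‖derivWithin γ' (Icc 0 1) t‖ₑ := by
        apply enorm_sub_le_lintegral_derivWithin_Icc_of_contDiffOn_Icc _ zero_le_one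
        rwa [← contMDiffOn_iff_contDiffOn]
      _ ≤ ∫⁻ t in Icc 0 1, C * ‖mfderivWithin 𝓘(ℝ, ℝ) I γ (Icc 0 1) t 1‖ₑ := by
        apply setLIntegral_mono' measurableSet_Icc (fun t ht ↦ ?_)
        have hd : mfderivWithin 𝓘(ℝ, ℝ) 𝓘(ℝ, E) γ' (Icc 0 1) t =
            (mfderiv I 𝓘(ℝ, E) (extChartAt I q) (γ t)) ∘L
              (mfderivWithin 𝓘(ℝ, ℝ) I γ (Icc 0 1) t) := by
          apply mfderiv_comp_mfderivWithin
          · exact mdifferentiableAt_extChartAt (hsrc t ht)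
          · exact hγ.mdifferentiableOn one_ne_zero _ ht
          · rw [uniqueMDiffWithinAt_iff_uniqueDiffWithinAt]
            exact uniqueDiffOn_Icc zero_lt_one _ ht
        rw [← fderivWithin_derivWithin, ← mfderivWithin_eq_fderivWithin]
        have := congr($hd 1)
        refine (congrArg _ this).trans_le ?_
        let := normedAddCommGroupTangentSpaceVectorSpace (extChartAt I q (γ t))
        let := normedSpaceTangentSpaceVectorSpace (extChartAt I q (γ t))
        refine ((mfderiv I 𝓘(ℝ, E) (extChartAt I q) (γ t)).le_opENorm
          (mfderivWithin 𝓘(ℝ, ℝ) I γ (Icc 0 1) t 1)).trans ?_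
        gcongr
        exact (hr (hin t ht)).1.le
      _ = C * pathELength I γ 0 1 := by
        rw [lintegral_const_mul' _ _ ENNReal.coe_ne_top,
          pathELength_eq_lintegral_mfderivWithin_Icc]
      _ ≤ C * L := by gcongr
  have h3 : riemannianEDist I y y' < r / 3 + r / 3 := by
    rwa [← IsRiemannianManifold.out (I := I) y y']
  -- The estimate holds for every `L` slightly above the distance; let `L` decrease to it.
  have : (𝓝[>] (riemannianEDist I y y')).NeBot := nhdsGT_neBot_of_exists_gt ⟨_, h3⟩
  refine ge_of_tendsto (f := fun L : ℝ≥0∞ => (C : ℝ≥0∞) * L) (x := 𝓝[>] (riemannianEDist I y y'))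
    ?_ ?_
  · exact (ENNReal.Tendsto.const_mul tendsto_id (Or.inr ENNReal.coe_ne_top)).mono_left
      nhdsWithin_le_nhds
  · filter_upwards [Ioo_mem_nhdsGT h3] with L hL using key L hL.1 hL.2.le

end Riemannian
-- Local lower bounds for immersions.
section AntilipschitzOn
open scoped NNReal

/-- A `C^1` map on a convex set whose derivative at a point is injective is bounded below near
that point. -/
lemma ContDiffWithinAt.exists_antilipschitz
    {E F : Type*} [NormedAddCommGroup E] [NormedSpace ℝ E] [FiniteDimensional ℝ E]
    [NormedAddCommGroup F] [NormedSpace ℝ F] {f : E → F} {s : Set E} {x : E}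
    (hf : ContDiffWithinAt ℝ 1 f s x) (hs : Convex ℝ s) (hu : UniqueDiffOn ℝ s) (hx : x ∈ s)
    (hinj : Function.Injective (fderivWithin ℝ f s x)) :
    ∃ C : ℝ≥0, ∃ t ∈ 𝓝[s] x, ∀ u ∈ t, ∀ v ∈ t, edist u v ≤ C * edist (f u) (f v) := by
  obtain ⟨K, K_pos, hK⟩ := LinearMap.exists_antilipschitzWith
    (fderivWithin ℝ f s x : E →ₗ[ℝ] F) (LinearMap.ker_eq_bot.2 hinj)
  have hK' : ∀ w, ‖w‖ ≤ K * ‖fderivWithin ℝ f s x w‖ := fun w => by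
    simpa using hK.le_mul_dist w 0
  have hcont : ContinuousWithinAt (fderivWithin ℝ f s) s x :=
    (hf.fderivWithin_right (m := 0) hu (by simp) hx).continuousWithinAt
  -- An oscillation of the derivative below half of its lower bound `1/K` costs only `‖u - v‖ / 2`,
  -- which is absorbed on the left.
  have hδ : (0 : ℝ) < (2 * K)⁻¹ := by positivity
  have h1 : ∀ᶠ y in 𝓝[s] x, ‖fderivWithin ℝ f s y - fderivWithin ℝ f s x‖ < (2 * K)⁻¹ := by
    simpa [dist_eq_norm] using hcont.eventually (Metric.ball_mem_nhds _ hδ)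
  have h2 : ∀ᶠ y in 𝓝[s] x, ContDiffWithinAt ℝ 1 f s y := by
    have := hf.eventually (by simp)
    rwa [insert_eq_of_mem hx] at this
  obtain ⟨r, r_pos, hr⟩ := Metric.mem_nhdsWithin_iff.1 (h1.and h2)
  refine ⟨2 * K, Metric.ball x r ∩ s, inter_mem (mem_nhdsWithin_of_mem_nhds (Metric.ball_mem_nhds x r_pos)) self_mem_nhdsWithin,
     fun u hu' v hv => ?_⟩
  have hconv : Convex ℝ (Metric.ball x r ∩ s) := (convex_ball x r).inter hs
  have hmv := hconv.norm_image_sub_le_of_norm_hasFDerivWithin_le'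
    (f := f) (f' := fderivWithin ℝ f s) (φ := fderivWithin ℝ f s x) (C := (2 * K)⁻¹)
    (fun y hy => ((hr hy).2.differentiableWithinAt one_ne_zero).hasFDerivWithinAt.mono
      inter_subset_right) (fun y hy => (hr hy).1.le) hv hu'
  have h3 := hK' (u - v)
  have h4 : ‖fderivWithin ℝ f s x (u - v)‖ ≤ ‖f u - f v‖ + (2 * K : ℝ)⁻¹ * ‖u - v‖ := by
    have := norm_sub_norm_le (fderivWithin ℝ f s x (u - v)) (f u - f v)
    rw [norm_sub_rev _ (f u - f v)] at this
    linarith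
  have hKp : (0 : ℝ) < K := K_pos
  have h5 : ‖u - v‖ ≤ 2 * K * ‖f u - f v‖ := by
    have := h3.trans (mul_le_mul_of_nonneg_left h4 K.2)
    have h6 : (K : ℝ) * ((2 * K : ℝ)⁻¹ * ‖u - v‖) = ‖u - v‖ / 2 := by field_simp
    rw [mul_add] at this
    change ‖u - v‖ ≤ K * ‖f u - f v‖ + (K : ℝ) * ((2 * K : ℝ)⁻¹ * ‖u - v‖) at this
    rw [h6] at this
    linarith
  rw [edist_nndist, edist_nndist]
  norm_cast
  rw [← NNReal.coe_le_coe]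
  simpa [dist_eq_norm] using h5

variable
  {E : Type*} [NormedAddCommGroup E] [NormedSpace ℝ E] [FiniteDimensional ℝ E]
  {H : Type*} [TopologicalSpace H] {I : ModelWithCorners ℝ E H}
  {M : Type*} [TopologicalSpace M] [ChartedSpace H M] [IsManifold I 1 M]
  {E' : Type*} [NormedAddCommGroup E'] [NormedSpace ℝ E']
  {H' : Type*} [TopologicalSpace H'] {I' : ModelWithCorners ℝ E' H'}
  {N : Type*} [TopologicalSpace N] [ChartedSpace H' N] [IsManifold I' 1 N]

/-- A `C^1` map with injective differential is bounded below in charts. -/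
lemma ContMDiff.exists_nhds_edist_extChartAt_le {f : M → N} (hf : ContMDiff I I' 1 f) {c y₀ : M}
    (hy₀ : y₀ ∈ (chartAt H c).source) (hinj : Function.Injective (mfderiv I I' f y₀)) :
    ∃ C : ℝ≥0, ∃ U ∈ 𝓝 y₀, ∀ y ∈ U, ∀ y' ∈ U,
      edist (extChartAt I c y) (extChartAt I c y') ≤
        C * edist (extChartAt I' (f y₀) (f y)) (extChartAt I' (f y₀) (f y')) := by
  have hsrc : y₀ ∈ (extChartAt I c).source := by rwa [extChartAt_source]
  set u₀ := extChartAt I c y₀ with hu₀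
  have hu₀t : u₀ ∈ (extChartAt I c).target := (extChartAt I c).map_source hsrc
  have hleft : (extChartAt I c).symm u₀ = y₀ := (extChartAt I c).left_inv hsrc
  have hu₀r : u₀ ∈ range I := extChartAt_target_subset_range c hu₀t
  have hsymm : ContMDiffWithinAt 𝓘(ℝ, E) I 1 (extChartAt I c).symm (range I) u₀ :=
    contMDiffWithinAt_extChartAt_symm_range c hu₀t
  set g : M → E' := extChartAt I' (f y₀) ∘ f with hg
  have hψ : ContMDiffAt I' 𝓘(ℝ, E') 1 (extChartAt I' (f y₀)) (f y₀) := contMDiffAt_extChartAt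
  have hgd : ContMDiffAt I 𝓘(ℝ, E') 1 g y₀ := hψ.comp y₀ hf.contMDiffAt
  set F : E → E' := g ∘ (extChartAt I c).symm with hF
  have hFd : ContMDiffWithinAt 𝓘(ℝ, E) 𝓘(ℝ, E') 1 F (range I) u₀ :=
    ContMDiffAt.comp_contMDiffWithinAt_of_eq hgd hsymm hleft
  have hFc : ContDiffWithinAt ℝ 1 F (range I) u₀ := contMDiffWithinAt_iff_contDiffWithinAt.1 hFd
  have hFinj : Function.Injective (fderivWithin ℝ F (range I) u₀) := by
    have hi1 := (isInvertible_mfderivWithin_extChartAt_symm hu₀t).injective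
    have hi2 := (isInvertible_mfderiv_extChartAt (I := I')
      (mem_extChartAt_source (I := I') (f y₀))).injective
    have hd1 : mfderivWithin 𝓘(ℝ, E) 𝓘(ℝ, E') F (range I) u₀ =
        (mfderiv I 𝓘(ℝ, E') g ((extChartAt I c).symm u₀)).comp
          (mfderivWithin 𝓘(ℝ, E) I (extChartAt I c).symm (range I) u₀) := by
      apply mfderiv_comp_mfderivWithin
      · rw [hleft]; exact hgd.mdifferentiableAt one_ne_zero
      · exact hsymm.mdifferentiableWithinAt one_ne_zero
      · exact I.uniqueMDiffOn _ hu₀r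
    have hd2 : mfderiv I 𝓘(ℝ, E') g y₀ =
        (mfderiv I' 𝓘(ℝ, E') (extChartAt I' (f y₀)) (f y₀)).comp (mfderiv I I' f y₀) :=
      mfderiv_comp y₀ (hψ.mdifferentiableAt one_ne_zero) (hf.mdifferentiable one_ne_zero y₀)
    rw [← mfderivWithin_eq_fderivWithin, hd1]
    rw [hleft, hd2]
    rw [hleft] at hi1
    intro v w hvw
    exact hi1 (hinj (hi2 hvw))
  obtain ⟨C, t, ht, hC⟩ := hFc.exists_antilipschitz I.convex_range I.uniqueDiffOn hu₀r hFinj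
  refine ⟨C, extChartAt I c ⁻¹' t ∩ (extChartAt I c).source, ?_, fun y hy y' hy' => ?_⟩
  · refine Filter.inter_mem ?_ (extChartAt_source_mem_nhds' hsrc)
    have := continuousAt_extChartAt' (I := I) hsrc
    refine (tendsto_nhdsWithin_iff.2 ⟨this, ?_⟩) ht
    filter_upwards [extChartAt_source_mem_nhds' hsrc] with z hz
    exact extChartAt_target_subset_range c ((extChartAt I c).map_source hz)
  · have := hC _ hy.1 _ hy'.1
    simpa only [hF, hg, Function.comp_apply, (extChartAt I c).left_inv hy.2,
      (extChartAt I c).left_inv hy'.2] using this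

end AntilipschitzOn

/-! ### Chart distance versus distance of the images on compact sets. -/

section ChartComparison
open scoped NNReal
variable
  {E : Type*} [NormedAddCommGroup E] [NormedSpace ℝ E] [FiniteDimensional ℝ E]
  {H : Type*} [TopologicalSpace H] {I : ModelWithCorners ℝ E H}
  {M : Type*} [TopologicalSpace M] [ChartedSpace H M] [IsManifold I 1 M]
  {E' : Type*} [NormedAddCommGroup E'] [NormedSpace ℝ E']
  {H' : Type*} [TopologicalSpace H'] {I' : ModelWithCorners ℝ E' H'}
  {N : Type*} [EMetricSpace N] [ChartedSpace H' N] [IsManifold I' 1 N]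
  [RiemannianBundle (fun x : N => TangentSpace I' x)]
  [IsContinuousRiemannianBundle E' (fun x : N => TangentSpace I' x)]
  [IsRiemannianManifold I' N]

/-- For an injective immersion `f` into a Riemannian manifold, the distance in a chart is bounded
on compact sets by the distance of the images. -/
lemma ContMDiff.exists_edist_extChartAt_le_of_isCompact {f : M → N} (hf : ContMDiff I I' 1 f)
    (hinj : Function.Injective f) (hd : ∀ y, Function.Injective (mfderiv I I' f y))
    {c : M} {K : Set M} (hK : IsCompact K) (hKc : K ⊆ (chartAt H c).source) :
    ∃ C : ℝ≥0, ∀ y ∈ K, ∀ y' ∈ K,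
      edist (extChartAt I c y) (extChartAt I c y') ≤ C * edist (f y) (f y') := by
  have hφ : ContinuousOn (extChartAt I c) K :=
    (continuousOn_extChartAt c).mono (by rwa [extChartAt_source])
  have key : ∃ C : ℝ≥0, ∀ z ∈ K ×ˢ K, z ∈ K ×ˢ K →
      edist (extChartAt I c z.1) (extChartAt I c z.2) ≤ C * edist (f z.1) (f z.2) := by
    -- Compactness of `K × K` reduces the claim to neighbourhoods of single pairs. Membership in `K
    -- × K` stays inside the predicate because off the diagonal the bound uses the diameter of the
    -- chart image of `K`.
    refine (hK.prod hK).induction_on (p := fun t => ∃ C : ℝ≥0, ∀ z ∈ t, z ∈ K ×ˢ K →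
      edist (extChartAt I c z.1) (extChartAt I c z.2) ≤ C * edist (f z.1) (f z.2)) ?_ ?_ ?_ ?_
    · exact ⟨0, fun z hz => by simp at hz⟩
    · rintro s t hst ⟨C, hC⟩
      exact ⟨C, fun z hz => hC z (hst hz)⟩
    · rintro s t ⟨C, hC⟩ ⟨D, hD⟩
      refine ⟨max C D, fun z hz hzK => ?_⟩
      rcases hz with hz | hz
      · refine (hC z hz hzK).trans ?_
        gcongr
        exact le_max_left _ _
      · refine (hD z hz hzK).trans ?_
        gcongr
        exact le_max_right _ _
    · rintro ⟨a, b⟩ ⟨ha, hb⟩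
      by_cases hab : a = b
      · subst hab
        obtain ⟨C, U, hU, hC⟩ := hf.exists_nhds_edist_extChartAt_le (c := c) (hKc ha) (hd a)
        obtain ⟨D, V, hV, hD⟩ := _root_.exists_nhds_edist_extChartAt_le I' (f a)
        have hW := Filter.inter_mem hU (hf.continuous.continuousAt hV)
        refine ⟨_, mem_nhdsWithin_of_mem_nhds (prod_mem_nhds hW hW), C * D, ?_⟩
        rintro ⟨y, y'⟩ ⟨hy, hy'⟩ -
        refine (hC y hy.1 y' hy'.1).trans ?_
        rw [ENNReal.coe_mul, mul_assoc]
        gcongr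
        exact hD _ hy.2 _ hy'.2
      -- Off the diagonal, injectivity keeps the image distance above some `δ > 0`, so the diameter
      -- divided by `δ` is a constant.
      · have hpos : 0 < edist (f a) (f b) := edist_pos.2 fun h => hab (hinj h)
        obtain ⟨δ, hδ, hδ'⟩ := ENNReal.lt_iff_exists_nnreal_btwn.1 hpos
        have hcont : Continuous fun z : M × M => edist (f z.1) (f z.2) :=
          (hf.continuous.comp continuous_fst).edist (hf.continuous.comp continuous_snd)
        have hDtop : Metric.ediam (extChartAt I c '' K) ≠ (⊤ : ℝ≥0∞) :=
          (hK.image_of_continuousOn hφ).isBounded.ediam_ne_top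
        refine ⟨{z | (δ : ℝ≥0∞) < edist (f z.1) (f z.2)},
          mem_nhdsWithin_of_mem_nhds (hcont.continuousAt.eventually (lt_mem_nhds hδ')),
          (Metric.ediam (extChartAt I c '' K)).toNNReal / δ, ?_⟩
        rintro ⟨y, y'⟩ hz ⟨hy, hy'⟩
        have hδ0 : δ ≠ 0 := by simpa using hδ.ne'
        refine (Metric.edist_le_ediam_of_mem (mem_image_of_mem _ hy)
          (mem_image_of_mem _ hy')).trans ?_
        rw [ENNReal.coe_div hδ0, ENNReal.coe_toNNReal hDtop]
        calc Metric.ediam (extChartAt I c '' K)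
            = Metric.ediam (extChartAt I c '' K) / δ * δ :=
              (ENNReal.div_mul_cancel (by simpa using hδ0) ENNReal.coe_ne_top).symm
          _ ≤ _ := by gcongr; exact le_of_lt hz
  obtain ⟨C, hC⟩ := key
  exact ⟨C, fun y hy y' hy' => hC (y, y') ⟨hy, hy'⟩ ⟨hy, hy'⟩⟩

end ChartComparison

/-! ### Volume of balls, uniformly in the centre. -/

section VolumeGrowth
open scoped NNReal

lemma IsContMDiffRiemannianBundle.isContinuousRiemannianBundle
    {EB : Type*} [NormedAddCommGroup EB] [NormedSpace ℝ EB]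
    {HB : Type*} [TopologicalSpace HB] (IB : ModelWithCorners ℝ EB HB) (k : ℕ∞ω)
    {B : Type*} [TopologicalSpace B] [ChartedSpace HB B]
    {F : Type*} [NormedAddCommGroup F] [NormedSpace ℝ F]
    {E : B → Type*} [TopologicalSpace (TotalSpace F E)] [∀ x, NormedAddCommGroup (E x)]
    [∀ x, InnerProductSpace ℝ (E x)] [FiberBundle F E] [VectorBundle ℝ F E]
    [h : IsContMDiffRiemannianBundle IB k F E] : IsContinuousRiemannianBundle F E := by
  obtain ⟨g, hg, hg'⟩ := h.exists_contMDiff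
  exact ⟨g, hg.continuous, hg'⟩

variable {n : ℕ} [NeZero n]
  {M : Type*} [EMetricSpace M] [ChartedSpace (EuclideanHalfSpace n) M]
  [IsManifold (𝓡∂ n) ∞ M]

/-- The field is the tangent map of the inverse chart applied to a constant vector field.
Differentiating within the chart target or within the range of the model is the same at points of
the target. -/
lemma continuousOn_coordVec (c : M) (i : Fin n) :
    ContinuousOn (fun u => (⟨(extChartAt (𝓡∂ n) c).symm u, coordVec c u i⟩ :
      TangentBundle (𝓡∂ n) M)) (extChartAt (𝓡∂ n) c).target := by
  have hs : ContMDiffOn 𝓘(ℝ, EuclideanSpace ℝ (Fin n)) (𝓡∂ n) 1 (extChartAt (𝓡∂ n) c).symm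
    (extChartAt (𝓡∂ n) c).target := contMDiffOn_extChartAt_symm c
  have hu : UniqueMDiffOn 𝓘(ℝ, EuclideanSpace ℝ (Fin n)) (extChartAt (𝓡∂ n) c).target :=
    by simpa using (uniqueMDiffOn_univ (I := 𝓡∂ n) (M := M)).uniqueMDiffOn_target_inter c
  have h1 := hs.continuousOn_tangentMapWithin le_rfl hu
  have h2 : Continuous fun u : EuclideanSpace ℝ (Fin n) =>
      (⟨u, EuclideanSpace.single i (1 : ℝ)⟩ :
        TangentBundle 𝓘(ℝ, EuclideanSpace ℝ (Fin n)) (EuclideanSpace ℝ (Fin n))) :=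
    (tangentBundleModelSpaceHomeomorph 𝓘(ℝ, EuclideanSpace ℝ (Fin n))).symm.continuous.comp
      (Continuous.prodMk continuous_id continuous_const)
  refine (h1.comp h2.continuousOn fun u hu => hu).congr fun u hu' => ?_
  simp only [Function.comp_apply, tangentMapWithin, coordVec]
  congr 2
  exact mfderivWithin_congr_set (extChartAt_target_eventuallyEq_of_mem hu').symm

variable [RiemannianBundle (fun x : M => TangentSpace (𝓡∂ n) x)]

lemma continuousOn_volumeDensity [IsContMDiffRiemannianBundle (𝓡∂ n) ∞ (EuclideanSpace ℝ (Fin n))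
      (fun x : M => TangentSpace (𝓡∂ n) x)] (c : M) :
    ContinuousOn (volumeDensity c) (extChartAt (𝓡∂ n) c).target := by
  have : IsContinuousRiemannianBundle (EuclideanSpace ℝ (Fin n))
      (fun x : M => TangentSpace (𝓡∂ n) x) :=
    IsContMDiffRiemannianBundle.isContinuousRiemannianBundle (𝓡∂ n) ∞
  refine Real.continuous_sqrt.comp_continuousOn ?_
  simp only [Matrix.det_apply]
  refine continuousOn_finsetSum _ fun s _ => ContinuousOn.const_smul ?_ _
  refine continuousOn_finsetProd _ fun i _ => ?_
  exact (continuousOn_coordVec c (s i)).inner_bundle (continuousOn_coordVec c i)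

/-- On compact subsets of the domain of a chart, the volume is bounded by a multiple of the
Lebesgue measure in the chart. -/
lemma exists_chartVolume_le [MeasurableSpace M] [BorelSpace M]
    [IsContMDiffRiemannianBundle (𝓡∂ n) ∞ (EuclideanSpace ℝ (Fin n))
      (fun x : M => TangentSpace (𝓡∂ n) x)] (c : M) {K : Set M} (hK : IsCompact K)
    (hKc : K ⊆ (extChartAt (𝓡∂ n) c).source) :
    ∃ B : ℝ≥0, ∀ S ⊆ K, MeasurableSet S → ∀ T, MeasurableSet T → extChartAt (𝓡∂ n) c '' S ⊆ T →
      chartVolume (n := n) c S ≤ B * volume T := by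
  set φ := extChartAt (𝓡∂ n) c with hφ
  have hφK : IsCompact (φ '' K) := hK.image_of_continuousOn ((continuousOn_extChartAt c).mono hKc)
  have hφt : φ '' K ⊆ φ.target := by
    rintro _ ⟨y, hy, rfl⟩
    exact φ.map_source (hKc hy)
  obtain ⟨B, hB⟩ := hφK.exists_bound_of_continuousOn ((continuousOn_volumeDensity c).mono hφt)
  have htarget : MeasurableSet φ.target := by
    rw [hφ, extChartAt_target]
    exact ((chartAt _ c).open_target.preimage (𝓡∂ n).continuous_symm).measurableSet.inter
      (𝓡∂ n).isClosed_range.measurableSet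
  refine ⟨B.toNNReal, fun S hSK hS T hT hST => ?_⟩
  set ν : Measure (EuclideanSpace ℝ (Fin n)) := (volume.restrict φ.target).withDensity
      fun u => ENNReal.ofReal (volumeDensity c u) with hν
  change Measure.map φ.symm ν S ≤ _
  -- Without measurability the push-forward is `0` by convention and there is nothing to prove.
  by_cases hm : AEMeasurable φ.symm ν
  swap
  · rw [Measure.map_of_not_aemeasurable hm]; simp
  rw [Measure.map_apply_of_aemeasurable hm hS]
  have h0 : ν φ.targetᶜ = 0 := by
    refine withDensity_absolutelyContinuous _ _ ?_
    rw [Measure.restrict_apply htarget.compl]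
    simp
  have hT' : MeasurableSet (T ∩ φ '' K) := hT.inter hφK.isClosed.measurableSet
  -- Outside the target the values of `φ.symm` carry no information; such stray points of the
  -- preimage lie in the null set `φ.targetᶜ`.
  have hsub : φ.symm ⁻¹' S ⊆ (T ∩ φ '' K) ∪ φ.targetᶜ := by
    intro u hu
    by_cases hut : u ∈ φ.target
    · refine Or.inl ⟨hST ⟨_, hu, φ.right_inv hut⟩, ⟨_, hSK hu, φ.right_inv hut⟩⟩
    · exact Or.inr hut
  calc ν (φ.symm ⁻¹' S) ≤ ν (T ∩ φ '' K) + ν φ.targetᶜ :=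
        (measure_mono hsub).trans (measure_union_le _ _)
    _ = ∫⁻ u in T ∩ φ '' K, ENNReal.ofReal (volumeDensity c u) ∂(volume.restrict φ.target) := by
        rw [h0, add_zero, hν, withDensity_apply _ hT']
    _ ≤ ∫⁻ u in T ∩ φ '' K, ENNReal.ofReal (volumeDensity c u) :=
        lintegral_mono' (Measure.restrict_mono_measure Measure.restrict_le_self _) le_rfl
    _ ≤ ∫⁻ u in T ∩ φ '' K, B.toNNReal := by
        refine setLIntegral_mono' hT' fun u hu => ?_
        exact ENNReal.ofReal_le_ofReal ((le_abs_self _).trans (hB u hu.2))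
    _ = B.toNNReal * volume (T ∩ φ '' K) := by simp
    _ ≤ B.toNNReal * volume T := by gcongr; exact inter_subset_left

variable [CompactSpace M] [MeasurableSpace M] [BorelSpace M]
  [IsContMDiffRiemannianBundle (𝓡∂ n) ∞ (EuclideanSpace ℝ (Fin n))
    (fun x : M => TangentSpace (𝓡∂ n) x)]
  {N : Type*} [EMetricSpace N] [ChartedSpace (EuclideanSpace ℝ (Fin n)) N]
  [IsManifold (𝓡 n) ∞ N] [RiemannianBundle (fun x : N => TangentSpace (𝓡 n) x)]
  [IsContMDiffRiemannianBundle (𝓡 n) ∞ (EuclideanSpace ℝ (Fin n))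
    (fun x : N => TangentSpace (𝓡 n) x)]
  [IsRiemannianManifold (𝓡 n) N]

/-- The volume of the part of a compact manifold that is contained in a ball of radius `r` of a
Riemannian manifold of the same dimension is bounded by a multiple of `r ^ n`. -/
lemma exists_riemannianVolume_ball_le {f : M → N} (hf : ContMDiff (𝓡∂ n) (𝓡 n) 1 f)
    (hinj : Function.Injective f) (hd : ∀ y, Function.Injective (mfderiv (𝓡∂ n) (𝓡 n) f y)) :
    ∃ A : ℝ≥0, ∀ (p : N) (r : ℝ≥0),
      riemannianVolume n M {y | edist p (f y) < r} ≤ A * (r : ℝ≥0∞) ^ n := by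
  have : IsContinuousRiemannianBundle (EuclideanSpace ℝ (Fin n))
      (fun x : N => TangentSpace (𝓡 n) x) :=
    IsContMDiffRiemannianBundle.isContinuousRiemannianBundle (𝓡 n) ∞
  set P := (SmoothPartitionOfUnity.exists_isSubordinate_chartAt_source (𝓡∂ n) M).choose with hP
  have hPs : P.IsSubordinate fun x => (chartAt (EuclideanHalfSpace n) x).source :=
    (SmoothPartitionOfUnity.exists_isSubordinate_chartAt_source (𝓡∂ n) M).choose_spec
  -- The volume is a sum over all points `c` of `M`, but only finitely many terms are nonzero.
  have hfin : {c : M | (Function.support (P c)).Nonempty}.Finite :=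
    P.locallyFinite.finite_nonempty_of_compact
  have hmeas : ∀ (p : N) (r : ℝ≥0), MeasurableSet {y | edist p (f y) < r} := fun p r =>
    (isOpen_lt (continuous_const.edist hf.continuous) continuous_const).measurableSet
  have hloc : ∀ c : M, ∃ A : ℝ≥0, ∀ (p : N) (r : ℝ≥0), ((chartVolume (n := n) c).withDensity
      fun y => ENNReal.ofReal (P c y)) {y | edist p (f y) < r} ≤ A * (r : ℝ≥0∞) ^ n := by
    intro c
    have hK : IsCompact (tsupport (P c)) := (isClosed_tsupport _).isCompact
    have hKc : tsupport (P c) ⊆ (extChartAt (𝓡∂ n) c).source := by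
      rw [extChartAt_source]; exact hPs c
    obtain ⟨B, hB⟩ := exists_chartVolume_le c hK hKc
    obtain ⟨C, hC⟩ := hf.exists_edist_extChartAt_le_of_isCompact hinj hd hK (hPs c)
    set V := volume (Metric.ball (0 : EuclideanSpace ℝ (Fin n)) 1) with hV
    have hVtop : V ≠ ⊤ := measure_ball_lt_top.ne
    refine ⟨B * ((2 * C) ^ n * V.toNNReal), fun p r => ?_⟩
    set S := {y | edist p (f y) < r} ∩ tsupport (P c) with hS
    have hSm : MeasurableSet S := (hmeas p r).inter (isClosed_tsupport _).measurableSet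
    have h1 : ((chartVolume (n := n) c).withDensity fun y => ENNReal.ofReal (P c y))
        {y | edist p (f y) < r} ≤ chartVolume (n := n) c S := by
      rw [withDensity_apply _ (hmeas p r)]
      calc ∫⁻ y in {y | edist p (f y) < r}, ENNReal.ofReal (P c y) ∂chartVolume (n := n) c
          ≤ ∫⁻ y in {y | edist p (f y) < r}, (tsupport (P c)).indicator 1 y
              ∂chartVolume (n := n) c := by
            refine lintegral_mono fun y => ?_
            by_cases hy : y ∈ tsupport (P c)
            · simpa [hy] using P.le_one c y
            · simp [image_eq_zero_of_notMem_tsupport hy]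
        _ = chartVolume (n := n) c S := by
            rw [lintegral_indicator_one (isClosed_tsupport _).measurableSet,
              Measure.restrict_apply (isClosed_tsupport _).measurableSet, inter_comm]
    refine h1.trans ?_
    rcases S.eq_empty_or_nonempty with hem | ⟨y₀, hy₀⟩
    · rw [hem]; simp
    -- The centre `p` need not lie in the image of `f`, so the ball is recentred at a point `y₀` of
    -- `S`; this doubles the radius.
    have h2 : extChartAt (𝓡∂ n) c '' S ⊆
        Metric.closedBall (extChartAt (𝓡∂ n) c y₀) ((2 * C : ℝ≥0) * r) := by
      rintro _ ⟨y, hy, rfl⟩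
      have h3 : edist (f y) (f y₀) ≤ r + r :=
        (edist_triangle_left _ _ p).trans (add_le_add hy.1.le hy₀.1.le)
      have h4 := (hC y hy.2 y₀ hy₀.2).trans (mul_le_mul_right h3 _)
      rw [Metric.mem_closedBall, ← NNReal.coe_mul, dist_nndist, NNReal.coe_le_coe,
        ← ENNReal.coe_le_coe, ← edist_nndist]
      refine h4.trans_eq ?_
      push_cast
      ring
    refine (hB S inter_subset_right hSm _ Metric.isClosed_closedBall.measurableSet h2).trans ?_
    rw [Measure.addHaar_closedBall _ _ (by positivity), finrank_euclideanSpace_fin, ← hV,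
      ← NNReal.coe_mul, ← NNReal.coe_pow, ENNReal.ofReal_coe_nnreal]
    refine le_of_eq ?_
    push_cast [ENNReal.coe_toNNReal hVtop]
    ring
  choose A hA using hloc
  refine ⟨∑ c ∈ hfin.toFinset, A c, fun p r => ?_⟩
  have hsum : riemannianVolume n M {y | edist p (f y) < r} =
      ∑' c : M, ((chartVolume (n := n) c).withDensity fun y => ENNReal.ofReal (P c y))
        {y | edist p (f y) < r} := Measure.sum_apply _ (hmeas p r)
  rw [hsum, tsum_eq_sum (s := hfin.toFinset)]
  · rw [ENNReal.ofNNReal_finsetSum, Finset.sum_mul]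
    exact Finset.sum_le_sum fun c _ => hA c p r
  · intro c hc
    have : (fun y => ENNReal.ofReal (P c y)) = 0 := by
      ext y
      by_contra hy
      refine hc (hfin.mem_toFinset.2 ⟨y, fun h => hy ?_⟩)
      simp [h]
    rw [this, withDensity_zero]
    simp

end VolumeGrowth

/-! ### The integral representation as a function: recurrence, derivative, bounds. -/

section BesselIntegral

/-- The integral `1/2 ∫ exp (a t - z cosh t) dt` over the real line, which represents `K_a(z)` in
the right half plane. -/
noncomputable def besselKInt (a : ℝ) (z : ℂ) : ℂ :=
  (1 / 2) * ∫ t : ℝ, Complex.exp (a * t - z * Real.cosh t)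

lemma norm_cexp_mul_sub_mul_cosh (a : ℝ) (z : ℂ) (t : ℝ) :
    ‖Complex.exp (a * t - z * Real.cosh t)‖ = Real.exp (a * t - z.re * Real.cosh t) := by
  rw [Complex.norm_exp]
  congr 1
  simp [-Complex.ofReal_cosh]

lemma continuous_cexp_mul_sub_mul_cosh (a : ℝ) (z : ℂ) :
    Continuous fun t : ℝ => Complex.exp (a * t - z * Real.cosh t) := by
  have := Real.continuous_cosh
  fun_prop

lemma Real.one_add_sq_div_two_le_cosh (t : ℝ) : 1 + t ^ 2 / 2 ≤ Real.cosh t := by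
  have h : ∀ s : ℝ, 0 ≤ s → 1 + s ^ 2 / 2 ≤ Real.cosh s := by
    intro s hs
    have h1 := Real.cosh_sq (s / 2)
    have h2 : Real.cosh s = 1 + 2 * Real.sinh (s / 2) ^ 2 := by
      have := Real.cosh_two_mul (s / 2)
      rw [mul_div_cancel₀ s two_ne_zero] at this
      rw [this, h1]; ring
    have h3 : s / 2 ≤ Real.sinh (s / 2) := Real.self_le_sinh_iff.2 (by positivity)
    have h4 : (s / 2) ^ 2 ≤ Real.sinh (s / 2) ^ 2 := by gcongr
    rw [h2]
    linarith
  have := h |t| (abs_nonneg t)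
  rwa [sq_abs, Real.cosh_abs] at this

/-- The bound `1 + t²/2 ≤ cosh t` gives a Gaussian majorant: half of the quadratic decay absorbs the
linear term `a t` by completing the square. -/
lemma integrable_exp_mul_sub_mul_cosh (a : ℝ) {x : ℝ} (hx : 0 < x) :
    Integrable fun t : ℝ => Real.exp (a * t - x * Real.cosh t) := by
  have h1 : Integrable fun t : ℝ => Real.exp (a ^ 2 / x) * Real.exp (-(x / 4) * t ^ 2) :=
    (integrable_exp_neg_mul_sq (by positivity)).const_mul _
  refine h1.mono' (by have := Real.continuous_cosh; fun_prop) (ae_of_all _ fun t => ?_)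
  rw [Real.norm_eq_abs, Real.abs_exp, ← Real.exp_add, Real.exp_le_exp]
  have h2 := mul_le_mul_of_nonneg_left (Real.one_add_sq_div_two_le_cosh t) hx.le
  have h3 : a * t ≤ a ^ 2 / x + x / 4 * t ^ 2 := by
    have : a ^ 2 / x + x / 4 * t ^ 2 - a * t = (a - x * t / 2) ^ 2 / x := by field_simp; ring
    have h4 : 0 ≤ (a - x * t / 2) ^ 2 / x := by positivity
    linarith
  nlinarith

lemma integrable_cexp_mul_sub_mul_cosh (a : ℝ) {z : ℂ} (hz : 0 < z.re) :
    Integrable fun t : ℝ => Complex.exp (a * t - z * Real.cosh t) := by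
  refine (integrable_exp_mul_sub_mul_cosh a hz).mono'
    (continuous_cexp_mul_sub_mul_cosh a z).aestronglyMeasurable (ae_of_all _ fun t => ?_)
  rw [norm_cexp_mul_sub_mul_cosh]

lemma exp_mul_cexp_add (a b : ℝ) (z : ℂ) (t : ℝ) :
    Complex.exp ((a + b : ℝ) * t - z * Real.cosh t) =
      Complex.exp (b * t) * Complex.exp (a * t - z * Real.cosh t) := by
  rw [← Complex.exp_add]
  congr 1
  push_cast
  ring

lemma besselKInt_neg (a : ℝ) (z : ℂ) : besselKInt (-a) z = besselKInt a z := by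
  unfold besselKInt
  rw [← integral_neg_eq_self]
  simp

/-- The recurrence `K_{a+1} - K_{a-1} = (2a/z) K_a`. -/
lemma besselKInt_add_one_sub (a : ℝ) {z : ℂ} (hz : 0 < z.re) :
    z * (besselKInt (a + 1) z - besselKInt (a - 1) z) = 2 * a * besselKInt a z := by
  have hi := integrable_cexp_mul_sub_mul_cosh a hz
  have hp := integrable_cexp_mul_sub_mul_cosh (a + 1) hz
  have hm := integrable_cexp_mul_sub_mul_cosh (a - 1) hz
  have hpm : Integrable fun t : ℝ => z / 2 * (Complex.exp ((a + 1 : ℝ) * t - z * Real.cosh t) -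
      Complex.exp ((a - 1 : ℝ) * t - z * Real.cosh t)) := (hp.sub hm).const_mul (z / 2)
  have hsum := (hi.const_mul (a : ℂ)).sub hpm
  -- The integral of a total derivative vanishes; writing `sinh t` with exponentials shifts the
  -- order by `±1`.
  have h0 := integral_eq_zero_of_hasDerivAt_of_integrable
    (f := fun t : ℝ => Complex.exp (a * t - z * Real.cosh t)) (fun t => ?_) hsum hi
  · have h1 : ∫ t : ℝ, ((a : ℂ) * Complex.exp (a * t - z * Real.cosh t) - z / 2 *
        (Complex.exp ((a + 1 : ℝ) * t - z * Real.cosh t) -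
          Complex.exp ((a - 1 : ℝ) * t - z * Real.cosh t))) = 0 := h0
    rw [integral_sub (hi.const_mul _) hpm, integral_const_mul,
      integral_const_mul, integral_sub hp hm] at h1
    unfold besselKInt
    linear_combination (-1 : ℂ) * h1
  · have hd : HasDerivAt (fun t : ℝ => (a : ℂ) * t - z * ((Real.cosh t : ℝ) : ℂ))
        ((a : ℂ) * 1 - z * ((Real.sinh t : ℝ) : ℂ)) t :=
      ((Complex.ofRealCLM.hasDerivAt (x := t)).const_mul (a : ℂ)).sub
        ((Real.hasDerivAt_cosh t).ofReal_comp.const_mul z)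
    refine hd.cexp.congr_deriv ?_
    simp only [Pi.sub_apply]
    rw [sub_eq_add_neg a 1, exp_mul_cexp_add, exp_mul_cexp_add, Complex.ofReal_sinh, Complex.sinh]
    push_cast
    rw [one_mul, neg_one_mul]
    ring

/-- Differentiation under the integral produces `-cosh t`, which splits into the orders `a ± 1`. On
`Re w > Re z / 2` the derivatives have a common majorant. -/
lemma hasDerivAt_besselKInt (a : ℝ) {z : ℂ} (hz : 0 < z.re) :
    HasDerivAt (besselKInt a) (-(besselKInt (a + 1) z + besselKInt (a - 1) z) / 2) z := by
  have hx : 0 < z.re / 2 := by positivity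
  have key := hasDerivAt_integral_of_dominated_loc_of_deriv_le (μ := volume)
    (F := fun (w : ℂ) (t : ℝ) => Complex.exp (a * t - w * Real.cosh t))
    (F' := fun (w : ℂ) (t : ℝ) => -(1 / 2 : ℂ) *
      (Complex.exp ((a + 1 : ℝ) * t - w * Real.cosh t) +
        Complex.exp ((a - 1 : ℝ) * t - w * Real.cosh t)))
    (bound := fun t => (1 / 2) * (Real.exp ((a + 1) * t - z.re / 2 * Real.cosh t) +
        Real.exp ((a - 1) * t - z.re / 2 * Real.cosh t)))
    (x₀ := z) (s := {w | z.re / 2 < w.re})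
    ((isOpen_lt continuous_const Complex.continuous_re).mem_nhds (half_lt_self hz))
    (Eventually.of_forall fun w => (continuous_cexp_mul_sub_mul_cosh a w).aestronglyMeasurable)
    (integrable_cexp_mul_sub_mul_cosh a hz)
    (((continuous_cexp_mul_sub_mul_cosh (a + 1) z).add
      (continuous_cexp_mul_sub_mul_cosh (a - 1) z)).const_mul _).aestronglyMeasurable
    (ae_of_all _ fun t w hw => ?_)
    (((integrable_exp_mul_sub_mul_cosh (a + 1) hx).add
      (integrable_exp_mul_sub_mul_cosh (a - 1) hx)).const_mul _)
    (ae_of_all _ fun t w hw => ?_)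
  · refine (key.2.const_mul (1 / 2 : ℂ)).congr_deriv ?_
    rw [integral_const_mul, integral_add (integrable_cexp_mul_sub_mul_cosh (a + 1) hz)
      (integrable_cexp_mul_sub_mul_cosh (a - 1) hz)]
    unfold besselKInt
    ring
  · rw [norm_mul]
    have h1 : ‖-(1 / 2 : ℂ)‖ = 1 / 2 := by simp
    rw [h1]
    gcongr
    refine (norm_add_le _ _).trans ?_
    rw [norm_cexp_mul_sub_mul_cosh, norm_cexp_mul_sub_mul_cosh]
    have hc := Real.cosh_pos t
    have hw' : z.re / 2 ≤ w.re := le_of_lt hw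
    gcongr
  · have hd : HasDerivAt (fun w : ℂ => (a : ℂ) * t - w * ((Real.cosh t : ℝ) : ℂ))
        (-(1 * ((Real.cosh t : ℝ) : ℂ))) w :=
      ((hasDerivAt_id w).mul_const _).const_sub _
    refine hd.cexp.congr_deriv ?_
    rw [sub_eq_add_neg a 1, exp_mul_cexp_add, exp_mul_cexp_add, Complex.ofReal_cosh, Complex.cosh]
    push_cast
    rw [one_mul, neg_one_mul]
    ring_nf

/-- `K_a` of integral order is defined as a limit in the order, so this continuity settles the
integral case. For orders within `1` of `a₀`, the integrand is dominated by the sum of those of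
orders `a₀ ± 1`. -/
lemma continuous_besselKInt_order {z : ℂ} (hz : 0 < z.re) :
    Continuous fun a : ℝ => besselKInt a z := by
  refine continuous_const.mul (continuous_iff_continuousAt.2 fun a₀ => ?_)
  refine continuousAt_of_dominated
    (bound := fun t => Real.exp ((a₀ + 1) * t - z.re * Real.cosh t) +
      Real.exp ((a₀ - 1) * t - z.re * Real.cosh t))
    (Eventually.of_forall fun a => (continuous_cexp_mul_sub_mul_cosh a z).aestronglyMeasurable)
    ?_ ((integrable_exp_mul_sub_mul_cosh _ hz).add (integrable_exp_mul_sub_mul_cosh _ hz))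
    (ae_of_all _ fun t => by fun_prop)
  filter_upwards [Icc_mem_nhds (sub_one_lt a₀) (lt_add_one a₀)] with a ha
  refine ae_of_all _ fun t => ?_
  rw [norm_cexp_mul_sub_mul_cosh]
  rcases le_total 0 t with ht | ht
  · refine le_trans ?_ (le_add_of_nonneg_right (Real.exp_pos _).le)
    have := mul_le_mul_of_nonneg_right ha.2 ht
    gcongr
  · refine le_trans ?_ (le_add_of_nonneg_left (Real.exp_pos _).le)
    have := mul_le_mul_of_nonpos_right ha.1 ht
    gcongr

/-- The Gamma integral in exponential coordinates. -/
lemma integral_exp_mul_sub_mul_exp {a y : ℝ} (ha : 0 < a) (hy : 0 < y) :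
    Integrable (fun t : ℝ => Real.exp (a * t - y * Real.exp t)) ∧
      ∫ t : ℝ, Real.exp (a * t - y * Real.exp t) = (1 / y) ^ a * Real.Gamma a := by
  have hd : ∀ x ∈ (univ : Set ℝ), HasDerivWithinAt Real.exp (Real.exp x) univ x := fun x _ =>
    (Real.hasDerivAt_exp x).hasDerivWithinAt
  have himg : Real.exp '' univ = Ioi 0 := by rw [image_univ, Real.range_exp]
  have heq : ∀ t : ℝ, |Real.exp t| • ((Real.exp t) ^ (a - 1) * Real.exp (-(y * Real.exp t))) =
      Real.exp (a * t - y * Real.exp t) := by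
    intro t
    rw [Real.abs_exp, smul_eq_mul, ← Real.exp_mul, ← Real.exp_add, ← Real.exp_add]
    congr 1
    ring
  have h1 := integrableOn_image_iff_integrableOn_abs_deriv_smul MeasurableSet.univ hd
    Real.exp_injective.injOn (fun v => v ^ (a - 1) * Real.exp (-(y * v)))
  have h2 := integral_image_eq_integral_abs_deriv_smul MeasurableSet.univ hd
    Real.exp_injective.injOn (fun v => v ^ (a - 1) * Real.exp (-(y * v)))
  simp only [heq, himg, integrableOn_univ, Measure.restrict_univ] at h1 h2
  refine ⟨h1.1 ?_, ?_⟩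
  · have := integrableOn_rpow_mul_exp_neg_mul_rpow (p := 1) (s := a - 1) (b := y)
      (by linarith) zero_lt_one hy
    simpa using this
  · rw [← h2, Real.integral_rpow_mul_exp_neg_mul_Ioi ha hy]

lemma Real.rpow_mul_exp_neg_le {b y : ℝ} (hb : 0 < b) (hy : 0 ≤ y) :
    y ^ b * Real.exp (-y) ≤ b ^ b := by
  have h1 : y / b ≤ Real.exp (y / b) := by linarith [Real.add_one_le_exp (y / b)]
  have h2 : (y / b) ^ b ≤ Real.exp y := by
    refine (Real.rpow_le_rpow (by positivity) h1 hb.le).trans_eq ?_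
    rw [← Real.exp_mul, div_mul_cancel₀ _ hb.ne']
  rw [Real.div_rpow hy hb.le, div_le_iff₀ (by positivity)] at h2
  rw [Real.exp_neg, ← div_eq_mul_inv, div_le_iff₀ (Real.exp_pos y), mul_comm]
  exact h2

/-- Polynomial bounds for `K_ν` in the right half plane. -/
lemma exists_norm_besselKInt_le {ν b : ℝ} (hb : 0 < b) (hνb : 0 < ν + b) :
    ∃ C : ℝ, 0 < C ∧ ∀ z : ℂ, 0 < z.re → ‖besselKInt ν z‖ ≤ C * z.re ^ (-(ν + 2 * b)) := by
  have hΓ := Real.Gamma_pos_of_pos hνb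
  refine ⟨1 / 2 * (b ^ b * Real.Gamma (ν + b)) * (1 / 2) ^ (-(ν + 2 * b)), by positivity,
    fun z hz => ?_⟩
  have hx : 0 < z.re / 2 := by positivity
  obtain ⟨hint, hval⟩ := integral_exp_mul_sub_mul_exp hνb hx
  have h1 : ‖∫ t : ℝ, Complex.exp (ν * t - z * Real.cosh t)‖ ≤
      ∫ t : ℝ, b ^ b * (z.re / 2) ^ (-b) * Real.exp ((ν + b) * t - z.re / 2 * Real.exp t) := by
    refine norm_integral_le_of_norm_le (hint.const_mul _) (ae_of_all _ fun t => ?_)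
    rw [norm_cexp_mul_sub_mul_cosh]
    -- Split `x cosh t` into its two exponentials. Trading `exp (-(x/2) e^(-t))` for a power raises
    -- the order from `ν` to `ν + b > 0`, so a convergent Gamma integral remains even when `ν ≤ 0`.
    have h2 := Real.rpow_mul_exp_neg_le hb (y := z.re / 2 * Real.exp (-t)) (by positivity)
    rw [Real.mul_rpow hx.le (Real.exp_pos _).le, ← Real.exp_mul, mul_assoc, ← Real.exp_add] at h2
    have h3 : Real.exp (ν * t - z.re * Real.cosh t) = (z.re / 2) ^ (-b) * ((z.re / 2) ^ b *
        Real.exp (-t * b + -(z.re / 2 * Real.exp (-t)))) *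
        Real.exp ((ν + b) * t - z.re / 2 * Real.exp t) := by
      rw [← mul_assoc, ← Real.rpow_add hx, neg_add_cancel, Real.rpow_zero, one_mul,
        ← Real.exp_add, Real.cosh_eq]
      congr 1
      ring
    rw [h3]
    have h4 := mul_le_mul_of_nonneg_left h2 (Real.rpow_nonneg hx.le (-b))
    refine mul_le_mul_of_nonneg_right (h4.trans_eq (mul_comm _ _)) (Real.exp_pos _).le
  rw [integral_const_mul, hval] at h1
  unfold besselKInt
  rw [norm_mul]
  have h5 : ‖(1 / 2 : ℂ)‖ = 1 / 2 := by simp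
  rw [h5]
  refine (mul_le_mul_of_nonneg_left h1 (by norm_num)).trans_eq ?_
  rw [one_div (z.re / 2), Real.inv_rpow hx.le, ← Real.rpow_neg hx.le]
  have h6 : z.re ^ (-(ν + 2 * b)) * (1 / 2) ^ (-(ν + 2 * b)) =
      (z.re / 2) ^ (-b) * (z.re / 2) ^ (-(ν + b)) := by
    rw [← Real.mul_rpow hz.le (by norm_num), ← Real.rpow_add hx]
    congr 1 <;> ring
  linear_combination (1 / 2 * b ^ b * Real.Gamma (ν + b)) * (-h6)

/-- `r ^ a K_a(r)` tends to `2 ^ a Γ(a) / 2` as `r → 0+`. -/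
lemma tendsto_rpow_mul_besselKInt {a : ℝ} (ha : 0 < a) :
    Tendsto (fun r : ℝ => ((r ^ a : ℝ) : ℂ) * besselKInt a r) (𝓝[>] 0)
      (𝓝 ((2 ^ a * Real.Gamma a / 2 : ℝ) : ℂ)) := by
  obtain ⟨hint, hval⟩ := integral_exp_mul_sub_mul_exp ha (y := 1 / 2) (by norm_num)
  -- The shift `t ↦ t - log r` turns `r^a exp (a t - r cosh t)` into this integrand, which converges
  -- dominatedly to that of a Gamma integral.
  have hlim : Tendsto (fun r : ℝ => ∫ t : ℝ, Real.exp (a * t - 1 / 2 * Real.exp t -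
      r ^ 2 / 2 * Real.exp (-t))) (𝓝[>] 0) (𝓝 (∫ t : ℝ, Real.exp (a * t - 1 / 2 * Real.exp t))) := by
    refine tendsto_integral_filter_of_dominated_convergence _
      (Eventually.of_forall fun r => by fun_prop)
      (Eventually.of_forall fun r => ae_of_all _ fun t => ?_) hint (ae_of_all _ fun t => ?_)
    · rw [Real.norm_eq_abs, Real.abs_exp]
      have : 0 ≤ r ^ 2 / 2 * Real.exp (-t) := by positivity
      exact Real.exp_le_exp.2 (by linarith)
    · have : Continuous fun r : ℝ => Real.exp (a * t - 1 / 2 * Real.exp t -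
        r ^ 2 / 2 * Real.exp (-t)) := by fun_prop
      have h := (this.tendsto 0).mono_left (nhdsWithin_le_nhds (s := Ioi 0))
      simpa using h
  rw [hval] at hlim
  have heq : ∀ᶠ r : ℝ in 𝓝[>] 0, ((1 / 2 * ∫ t : ℝ, Real.exp (a * t - 1 / 2 * Real.exp t -
      r ^ 2 / 2 * Real.exp (-t)) : ℝ) : ℂ) = ((r ^ a : ℝ) : ℂ) * besselKInt a r := by
    filter_upwards [self_mem_nhdsWithin] with r hr
    have hr : 0 < r := hr
    have h1 : ∫ t : ℝ, Complex.exp (a * t - r * Real.cosh t) =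
        ((∫ t : ℝ, Real.exp (a * t - r * Real.cosh t) : ℝ) : ℂ) := by
      rw [← integral_complex_ofReal]
      congr 1
      ext t
      push_cast
      rfl
    unfold besselKInt
    rw [h1, ← integral_sub_right_eq_self (μ := volume)
      (fun t : ℝ => Real.exp (a * t - r * Real.cosh t)) (Real.log r)]
    have h2 : ∀ t : ℝ, Real.exp (a * t - 1 / 2 * Real.exp t - r ^ 2 / 2 * Real.exp (-t)) =
        r ^ a * Real.exp (a * (t - Real.log r) - r * Real.cosh (t - Real.log r)) := by
      intro t
      rw [Real.rpow_def_of_pos hr, ← Real.exp_add, Real.cosh_eq, neg_sub, Real.exp_sub t,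
        Real.exp_sub (Real.log r), Real.exp_log hr, Real.exp_neg]
      congr 1
      field_simp
      ring
    simp only [h2, integral_const_mul]
    push_cast
    ring
  refine (((Complex.continuous_ofReal.tendsto _).comp (hlim.const_mul (1 / 2))).congr' heq).trans ?_
  refine le_of_eq ?_
  congr 2
  norm_num
  ring

end BesselIntegral

/-! ### The power series of `I_a`. -/

section BesselSeries

/-- The entire function `∑ₖ w ^ k / (Γ(k + a + 1) k!)`, so that
`I_a(z) = (z/2) ^ a besselSeries a ((z/2) ^ 2)`. -/
noncomputable def besselSeries (a : ℝ) (w : ℂ) : ℂ :=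
  ∑' k : ℕ, (Complex.Gamma (k + a + 1))⁻¹ * (w ^ k / (k.factorial : ℂ))

/-- On `[2, ∞)` the Gamma function is at least `1`; only finitely many arguments `k + a + 1` are
smaller. -/
lemma exists_norm_inv_Gamma_le (a : ℝ) :
    ∃ B : ℝ, ∀ k : ℕ, ‖(Complex.Gamma (k + a + 1))⁻¹‖ ≤ B := by
  obtain ⟨K, hK⟩ := exists_nat_ge (1 - a)
  have hlarge : ∀ k : ℕ, K ≤ k → ‖(Complex.Gamma (k + a + 1))⁻¹‖ ≤ 1 := by
    intro k hk
    have hk' : (2 : ℝ) ≤ k + a + 1 := by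
      have : (K : ℝ) ≤ k := by exact_mod_cast hk
      linarith
    have h1 : (1 : ℝ) ≤ Real.Gamma (k + a + 1) := by
      have := Real.Gamma_strictMonoOn_Ici.monotoneOn self_mem_Ici hk' hk'
      rwa [Real.Gamma_two] at this
    have h2 : Complex.Gamma (k + a + 1) = (Real.Gamma (k + a + 1) : ℂ) := by
      rw [← Complex.Gamma_ofReal]; push_cast; rfl
    rw [h2, norm_inv, Complex.norm_real, Real.norm_of_nonneg (by linarith)]
    exact inv_le_one_of_one_le₀ h1
  refine ⟨1 + ∑ k ∈ Finset.range K, ‖(Complex.Gamma (k + a + 1))⁻¹‖, fun k => ?_⟩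
  have hnn : 0 ≤ ∑ k ∈ Finset.range K, ‖(Complex.Gamma (k + a + 1))⁻¹‖ :=
    Finset.sum_nonneg fun _ _ => norm_nonneg _
  by_cases hk : k < K
  · have := Finset.single_le_sum (f := fun k : ℕ => ‖(Complex.Gamma (k + a + 1))⁻¹‖)
      (fun _ _ => norm_nonneg _) (Finset.mem_range.2 hk)
    linarith
  · linarith [hlarge k (not_lt.1 hk)]

lemma summable_besselSeries (a : ℝ) (w : ℂ) :
    Summable fun k : ℕ => (Complex.Gamma (k + a + 1))⁻¹ * (w ^ k / (k.factorial : ℂ)) := by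
  obtain ⟨B, hB⟩ := exists_norm_inv_Gamma_le a
  refine Summable.of_norm_bounded (g := fun k : ℕ => B * (‖w‖ ^ k / k.factorial))
    ((Real.summable_pow_div_factorial ‖w‖).mul_left B) fun k => ?_
  rw [norm_mul, norm_div, norm_pow, Complex.norm_natCast]
  gcongr
  exact hB k

/-- This isolates the branched power; the remaining factor is entire. -/
lemma besselI_eq (a : ℝ) {z : ℂ} (hz : z ≠ 0) :
    besselI a z = (z / 2) ^ (a : ℂ) * besselSeries a ((z / 2) ^ 2) := by
  unfold besselI besselSeries
  rw [← tsum_mul_left]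
  congr 1
  ext k
  have hz2 : z / 2 ≠ 0 := div_ne_zero hz two_ne_zero
  have : (z / 2) ^ (2 * (k : ℂ)) = ((z / 2) ^ 2) ^ k := by
    rw [← pow_mul, ← Complex.cpow_natCast]
    push_cast
    rfl
  rw [Complex.cpow_add _ _ hz2, this, div_eq_mul_inv, mul_inv]
  ring

/-- The contiguity relation of the series. -/
lemma besselSeries_sub_one (a : ℝ) (w : ℂ) :
    besselSeries (a - 1) w = a * besselSeries a w + w * besselSeries (a + 1) w := by
  -- Here `1/Γ(k+a) = (k+a)/Γ(k+a+1)`, which also holds at the poles. The part with factor `k`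
  -- cancels against `k!` and becomes the series of order `a + 1` after an index shift.
  have hterm : ∀ k : ℕ, (Complex.Gamma (k + (a - 1 : ℝ) + 1))⁻¹ * (w ^ k / (k.factorial : ℂ)) =
      (a : ℂ) * ((Complex.Gamma (k + a + 1))⁻¹ * (w ^ k / (k.factorial : ℂ))) +
        (k : ℂ) * ((Complex.Gamma (k + a + 1))⁻¹ * (w ^ k / (k.factorial : ℂ))) := by
    intro k
    have h := Complex.one_div_Gamma_eq_self_mul_one_div_Gamma_add_one (k + (a - 1 : ℝ) + 1)
    rw [h]
    push_cast
    rw [show (k : ℂ) + (a - 1) + 1 = k + a by ring]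
    ring
  have hk : ∀ k : ℕ, ((k + 1 : ℕ) : ℂ) * ((Complex.Gamma ((k + 1 : ℕ) + a + 1))⁻¹ *
      (w ^ (k + 1) / ((k + 1).factorial : ℂ))) =
      w * ((Complex.Gamma (k + (a + 1 : ℝ) + 1))⁻¹ * (w ^ k / (k.factorial : ℂ))) := by
    intro k
    have h1 : ((k + 1 : ℕ) : ℂ) ≠ 0 := Nat.cast_ne_zero.2 (Nat.succ_ne_zero k)
    have h2 : (k.factorial : ℂ) ≠ 0 := Nat.cast_ne_zero.2 k.factorial_ne_zero
    rw [Nat.factorial_succ, Nat.cast_mul, pow_succ]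
    have h3 : ((k + 1 : ℕ) : ℂ) + a + 1 = k + (a + 1 : ℝ) + 1 := by push_cast; ring
    rw [h3]
    field_simp
  have hsum1 : Summable fun k : ℕ =>
      (k : ℂ) * ((Complex.Gamma (k + a + 1))⁻¹ * (w ^ k / (k.factorial : ℂ))) := by
    refine (summable_nat_add_iff 1).1 ?_
    simp only [hk]
    exact (summable_besselSeries (a + 1) w).mul_left w
  unfold besselSeries
  simp only [hterm]
  rw [((summable_besselSeries a w).mul_left (a : ℂ)).tsum_add hsum1, tsum_mul_left,
    hsum1.tsum_eq_zero_add]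
  simp only [hk, tsum_mul_left, Nat.cast_zero, zero_mul, zero_add]

lemma hasDerivAt_besselSeries (a : ℝ) (w : ℂ) :
    HasDerivAt (besselSeries a) (besselSeries (a + 1) w) w := by
  obtain ⟨B, hB⟩ := exists_norm_inv_Gamma_le a
  set R : ℝ := ‖w‖ + 1 with hR
  have hR0 : 0 < R := by positivity
  have hu : Summable fun k : ℕ => B * ((k : ℝ) * R ^ (k - 1) / k.factorial) := by
    refine Summable.mul_left B ((summable_nat_add_iff 1).1 ?_)
    refine (Real.summable_pow_div_factorial R).congr fun k => ?_
    rw [Nat.factorial_succ]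
    push_cast
    have h1 : (k : ℝ) + 1 ≠ 0 := by positivity
    have h2 : (k.factorial : ℝ) ≠ 0 := by positivity
    field_simp
  have key := hasDerivAt_tsum_of_isPreconnected (𝕜 := ℂ) (t := Metric.ball 0 R) (y₀ := 0) (y := w)
    (g := fun (k : ℕ) (v : ℂ) => (Complex.Gamma (k + a + 1))⁻¹ * (v ^ k / (k.factorial : ℂ)))
    (g' := fun (k : ℕ) (v : ℂ) =>
      (Complex.Gamma (k + a + 1))⁻¹ * ((k : ℂ) * v ^ (k - 1) / (k.factorial : ℂ)))
    hu Metric.isOpen_ball (convex_ball 0 R).isPreconnected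
    (fun k v _ => ((hasDerivAt_pow k v).div_const _).const_mul _) (fun k v hv => ?_)
    (Metric.mem_ball_self hR0) (summable_besselSeries a 0) (by simp [hR])
  · refine key.congr_deriv ?_
    have hk : ∀ k : ℕ, (Complex.Gamma ((k + 1 : ℕ) + a + 1))⁻¹ *
        (((k + 1 : ℕ) : ℂ) * w ^ (k + 1 - 1) / ((k + 1).factorial : ℂ)) =
        (Complex.Gamma (k + (a + 1 : ℝ) + 1))⁻¹ * (w ^ k / (k.factorial : ℂ)) := by
      intro k
      have h1 : ((k + 1 : ℕ) : ℂ) ≠ 0 := Nat.cast_ne_zero.2 (Nat.succ_ne_zero k)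
      have h2 : (k.factorial : ℂ) ≠ 0 := Nat.cast_ne_zero.2 k.factorial_ne_zero
      have h3 : ((k + 1 : ℕ) : ℂ) + a + 1 = k + (a + 1 : ℝ) + 1 := by push_cast; ring
      rw [h3, Nat.factorial_succ, Nat.cast_mul, Nat.add_sub_cancel]
      congr 1
      field_simp
    rw [Summable.tsum_eq_zero_add]
    · simp only [hk, Nat.cast_zero, zero_mul, zero_div, mul_zero, zero_add]
      rfl
    · refine (summable_nat_add_iff 1).1 ?_
      simp only [hk]
      exact summable_besselSeries (a + 1) w
  · have hv' : ‖v‖ ≤ R := by simpa using (Metric.mem_ball.1 hv).le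
    rw [norm_mul, norm_div, norm_mul, norm_pow, Complex.norm_natCast, Complex.norm_natCast]
    have hB0 : 0 ≤ B := (norm_nonneg _).trans (hB 0)
    gcongr
    exact hB k

lemma besselSeries_zero (a : ℝ) : besselSeries a 0 = (Complex.Gamma (a + 1))⁻¹ := by
  unfold besselSeries
  rw [tsum_eq_single 0]
  · simp
  · intro k hk
    simp [hk]

lemma continuous_besselSeries (a : ℝ) : Continuous (besselSeries a) :=
  continuous_iff_continuousAt.2 fun w => (hasDerivAt_besselSeries a w).continuousAt

lemma besselKAux_neg (a : ℝ) (z : ℂ) : besselKAux (-a) z = besselKAux a z := by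
  unfold besselKAux
  rw [neg_neg, mul_neg, Real.sin_neg, Complex.ofReal_neg, div_neg, ← neg_div, neg_sub]

lemma besselI_sub_one_sub (a : ℝ) {z : ℂ} (hz : z ≠ 0) :
    z * (besselI (a - 1) z - besselI (a + 1) z) = 2 * a * besselI a z := by
  have hz2 : z / 2 ≠ 0 := div_ne_zero hz two_ne_zero
  rw [besselI_eq _ hz, besselI_eq _ hz, besselI_eq _ hz, besselSeries_sub_one]
  push_cast
  rw [Complex.cpow_sub _ _ hz2, Complex.cpow_add _ _ hz2, Complex.cpow_one]
  field_simp
  ring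

/-- A shift of the order by `±1` flips the sign of `sin (π a)`, so the recurrences of `I_a` and
`I_{-a}` combine to the one that `besselKInt` satisfies. -/
lemma besselKAux_add_one_sub (a : ℝ) {z : ℂ} (hz : z ≠ 0) :
    z * (besselKAux (a + 1) z - besselKAux (a - 1) z) = 2 * a * besselKAux a z := by
  have h1 := besselI_sub_one_sub a hz
  have h2 := besselI_sub_one_sub (-a) hz
  have hs1 : Real.sin (Real.pi * (a + 1)) = -Real.sin (Real.pi * a) := by
    rw [mul_add, mul_one, Real.sin_add_pi]
  have hs2 : Real.sin (Real.pi * (a - 1)) = -Real.sin (Real.pi * a) := by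
    rw [mul_sub, mul_one, Real.sin_sub_pi]
  unfold besselKAux
  rw [hs1, hs2, neg_add', neg_sub', sub_neg_eq_add]
  push_cast at h1 h2 ⊢
  rw [div_neg, div_neg]
  linear_combination (Real.pi / 2 / Complex.sin (Real.pi * a) : ℂ) * (-h2 - h1)

end BesselSeries

/-! ### The series definition agrees with the integral. -/

section BesselIdentity

/-- A linear system of two equations on `(0, ∞)` with coefficients that are integrable at `0` has
only the trivial solution with limit `0` at `0`. -/
lemma eq_zero_of_singular_linear_system {D E : ℝ → ℂ} {p q Φ : ℝ → ℝ} {L : ℝ}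
    (hp : ∀ r, 0 < r → 0 ≤ p r) (hq : ∀ r, 0 < r → 0 ≤ q r)
    (hD : ∀ r, 0 < r → HasDerivAt D (-(p r : ℂ) * E r) r)
    (hE : ∀ r, 0 < r → HasDerivAt E (-(q r : ℂ) * D r) r)
    (hΦ : ∀ r, 0 < r → HasDerivAt Φ (p r + q r) r) (hΦ0 : Tendsto Φ (𝓝[>] 0) (𝓝 L))
    (hD0 : Tendsto D (𝓝[>] 0) (𝓝 0)) (hE0 : Tendsto E (𝓝[>] 0) (𝓝 0)) {r : ℝ} (hr : 0 < r) :
    D r = 0 := by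
  -- A Grönwall argument: the energy grows at rate at most `p + q`, so the integrating factor `exp
  -- (-Φ)` makes it nonincreasing. It is nonnegative and tends to `0` at `0`, hence vanishes.
  set Q : ℝ → ℝ := fun r => (‖D r‖ ^ 2 + ‖E r‖ ^ 2) * Real.exp (-Φ r) with hQ
  have hQd : ∀ s, 0 < s → HasDerivAt Q ((2 * inner ℝ (D s) (-(p s : ℂ) * E s) +
      2 * inner ℝ (E s) (-(q s : ℂ) * D s)) * Real.exp (-Φ s) +
      (‖D s‖ ^ 2 + ‖E s‖ ^ 2) * (Real.exp (-Φ s) * -(p s + q s))) s := fun s hs =>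
    ((hD s hs).norm_sq.add (hE s hs).norm_sq).mul (hΦ s hs).neg.exp
  have hanti : AntitoneOn Q (Ioi 0) := by
    refine antitoneOn_of_deriv_nonpos (convex_Ioi 0)
      (fun s hs => (hQd s hs).continuousAt.continuousWithinAt)
      (fun s hs => ?_) (fun s hs => ?_)
    · rw [interior_Ioi] at hs
      exact (hQd s hs).differentiableAt.differentiableWithinAt
    · rw [interior_Ioi] at hs
      rw [(hQd s hs).deriv]
      have hps := hp s hs
      have hqs := hq s hs
      have h1 : inner ℝ (D s) (-(p s : ℂ) * E s) ≤ p s * (‖D s‖ * ‖E s‖) := by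
        refine (real_inner_le_norm _ _).trans_eq ?_
        rw [norm_mul, norm_neg, Complex.norm_real, Real.norm_of_nonneg hps]
        ring
      have h2 : inner ℝ (E s) (-(q s : ℂ) * D s) ≤ q s * (‖D s‖ * ‖E s‖) := by
        refine (real_inner_le_norm _ _).trans_eq ?_
        rw [norm_mul, norm_neg, Complex.norm_real, Real.norm_of_nonneg hqs]
        ring
      have h3 : 2 * (‖D s‖ * ‖E s‖) ≤ ‖D s‖ ^ 2 + ‖E s‖ ^ 2 := by
        nlinarith [sq_nonneg (‖D s‖ - ‖E s‖)]
      have h4 := mul_le_mul_of_nonneg_left h3 (add_nonneg hps hqs)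
      have h5 : 2 * inner ℝ (D s) (-(p s : ℂ) * E s) + 2 * inner ℝ (E s) (-(q s : ℂ) * D s) -
          (‖D s‖ ^ 2 + ‖E s‖ ^ 2) * (p s + q s) ≤ 0 := by nlinarith
      have h6 := mul_nonpos_of_nonpos_of_nonneg h5 (Real.exp_pos (-Φ s)).le
      linarith
  have hQ0 : Tendsto Q (𝓝[>] 0) (𝓝 0) := by
    have := ((hD0.norm.pow 2).add (hE0.norm.pow 2)).mul
      ((Real.continuous_exp.tendsto _).comp hΦ0.neg)
    simpa using this
  have hle : Q r ≤ 0 := by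
    refine ge_of_tendsto hQ0 ?_
    filter_upwards [Ioo_mem_nhdsGT hr] with s hs
    exact hanti hs.1 hr hs.2.le
  have h7 : ‖D r‖ ^ 2 + ‖E r‖ ^ 2 ≤ 0 := by
    by_contra h
    exact absurd hle (not_le.2 (mul_pos (not_le.1 h) (Real.exp_pos _)))
  have h8 : ‖D r‖ ^ 2 = 0 := le_antisymm (by nlinarith [sq_nonneg ‖E r‖]) (sq_nonneg _)
  simpa using h8

/-- The derivative and the recurrence give `(r^a K_a)' = -r^a K_{a-1}`, and `K_{a-1} = K_{1-a}`.
Thus the orders `a` and `1 - a` form a closed first-order system. -/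
lemma hasDerivAt_rpow_mul_besselKInt {a r : ℝ} (hr : 0 < r) :
    HasDerivAt (fun r : ℝ => ((r ^ a : ℝ) : ℂ) * besselKInt a r)
      (-((r ^ (2 * a - 1) : ℝ) : ℂ) * (((r ^ (1 - a) : ℝ) : ℂ) * besselKInt (1 - a) r)) r := by
  have hre : 0 < (r : ℂ).re := by simpa
  have h1 := (Real.hasDerivAt_rpow_const (p := a) (Or.inl hr.ne')).ofReal_comp.mul
    (hasDerivAt_besselKInt a hre).comp_ofReal
  refine h1.congr_deriv ?_
  have h2 := besselKInt_add_one_sub a hre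
  have h3 : besselKInt (1 - a) r = besselKInt (a - 1) r := by rw [← besselKInt_neg, neg_sub]
  have h4 : r ^ (2 * a - 1) * r ^ (1 - a) = r ^ a := by
    rw [← Real.rpow_add hr]; congr 1; ring
  have h5 : r ^ a = r ^ (a - 1) * r := by
    rw [← Real.rpow_add_one hr.ne']; congr 1; ring
  rw [← mul_assoc, neg_mul, ← Complex.ofReal_mul, h4, h3, h5]
  push_cast
  linear_combination (-(r ^ (a - 1) : ℝ) / 2 : ℂ) * h2

/-- The function `r ^ a (I_{-a}(r) - I_a(r)) π / (2 sin(π a))`, written as a smooth function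
of `r > 0`. -/
lemma rpow_mul_besselKAux_eq {a r : ℝ} (hr : 0 < r) :
    ((r ^ a : ℝ) : ℂ) * besselKAux a r = (Real.pi / 2 / Real.sin (Real.pi * a) : ℝ) *
      (((2 ^ a : ℝ) : ℂ) * besselSeries (-a) (((r / 2) ^ 2 : ℝ) : ℂ) -
        ((2 ^ (-a) * r ^ (2 * a) : ℝ) : ℂ) * besselSeries a (((r / 2) ^ 2 : ℝ) : ℂ)) := by
  have hr' : (r : ℂ) ≠ 0 := by exact_mod_cast hr.ne'
  have hr2 : 0 ≤ r / 2 := by positivity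
  have h1 : ∀ b : ℝ, ((r : ℂ) / 2) ^ (b : ℂ) = (((r / 2) ^ b : ℝ) : ℂ) := by
    intro b
    rw [Complex.ofReal_cpow hr2]; push_cast; rfl
  have h2 : r ^ a * (r / 2) ^ (-a) = 2 ^ a := by
    rw [Real.div_rpow hr.le zero_le_two, Real.rpow_neg hr.le, Real.rpow_neg zero_le_two]
    have := (Real.rpow_pos_of_pos hr a).ne'
    field_simp
  have h3 : r ^ a * (r / 2) ^ a = 2 ^ (-a) * r ^ (2 * a) := by
    rw [Real.div_rpow hr.le zero_le_two, Real.rpow_neg zero_le_two, two_mul, Real.rpow_add hr]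
    ring
  unfold besselKAux
  rw [besselI_eq _ hr', besselI_eq _ hr', h1, h1, ← h2, ← h3]
  push_cast
  ring

/-- The same system as for `besselKInt`, so that the differences solve it too. The two orders share
the factor `sin (π a) = sin (π (1 - a))`. -/
lemma hasDerivAt_rpow_mul_besselKAux {a r : ℝ} (hr : 0 < r) :
    HasDerivAt (fun r : ℝ => ((r ^ a : ℝ) : ℂ) * besselKAux a r)
      (-((r ^ (2 * a - 1) : ℝ) : ℂ) * (((r ^ (1 - a) : ℝ) : ℂ) * besselKAux (1 - a) r)) r := by
  have hw : HasDerivAt (fun r : ℝ => (((r / 2) ^ 2 : ℝ) : ℂ)) ((r / 2 : ℝ) : ℂ) r := by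
    have : HasDerivAt (fun r : ℝ => (r / 2) ^ 2) (r / 2) r := by
      refine (((hasDerivAt_id r).div_const 2).pow 2).congr_deriv ?_
      simp only [id_eq]
      ring
    exact this.ofReal_comp
  have hF : ∀ b : ℝ, HasDerivAt (fun r : ℝ => besselSeries b (((r / 2) ^ 2 : ℝ) : ℂ))
      (besselSeries (b + 1) (((r / 2) ^ 2 : ℝ) : ℂ) * ((r / 2 : ℝ) : ℂ)) r := fun b =>
    (hasDerivAt_besselSeries b _).comp r hw
  have hpow : HasDerivAt (fun r : ℝ => ((2 ^ (-a) * r ^ (2 * a) : ℝ) : ℂ))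
      ((2 ^ (-a) * (2 * a * r ^ (2 * a - 1)) : ℝ) : ℂ) r :=
    ((Real.hasDerivAt_rpow_const (Or.inl hr.ne')).const_mul _).ofReal_comp
  have h := (((hF (-a)).const_mul ((2 ^ a : ℝ) : ℂ)).sub (hpow.mul (hF a))).const_mul
    ((Real.pi / 2 / Real.sin (Real.pi * a) : ℝ) : ℂ)
  have heq : (fun r : ℝ => ((r ^ a : ℝ) : ℂ) * besselKAux a r) =ᶠ[𝓝 r] fun r : ℝ =>
      (Real.pi / 2 / Real.sin (Real.pi * a) : ℝ) *
      (((2 ^ a : ℝ) : ℂ) * besselSeries (-a) (((r / 2) ^ 2 : ℝ) : ℂ) -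
        ((2 ^ (-a) * r ^ (2 * a) : ℝ) : ℂ) * besselSeries a (((r / 2) ^ 2 : ℝ) : ℂ)) := by
    filter_upwards [lt_mem_nhds hr] with s hs using rpow_mul_besselKAux_eq hs
  refine (h.congr_of_eventuallyEq heq).congr_deriv ?_
  have hsin : Real.sin (Real.pi * (1 - a)) = Real.sin (Real.pi * a) := by
    rw [mul_sub, mul_one, Real.sin_pi_sub]
  have hc := besselSeries_sub_one a (((r / 2) ^ 2 : ℝ) : ℂ)
  rw [rpow_mul_besselKAux_eq hr, hsin, neg_sub, show -a + 1 = 1 - a by ring, hc]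
  have e1 : r ^ (2 * a) = r ^ (2 * a - 1) * r := by
    rw [← Real.rpow_add_one hr.ne']; congr 1; ring
  have e2 : r ^ (2 * (1 - a)) * r ^ (2 * a - 1) = r := by
    rw [← Real.rpow_add hr]; ring_nf; exact Real.rpow_one r
  have e3 : (2 : ℝ) ^ (1 - a) = 2 * 2 ^ (-a) := by
    rw [sub_eq_add_neg, Real.rpow_add two_pos, Real.rpow_one]
  have e4 : (2 : ℝ) ^ (a - 1) = 2 ^ a / 2 := by
    rw [Real.rpow_sub two_pos, Real.rpow_one]
  rw [e1, e3, e4]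
  have e2' : ((r ^ (2 * (1 - a)) : ℝ) : ℂ) * ((r ^ (2 * a - 1) : ℝ) : ℂ) = r := by
    exact_mod_cast e2
  simp only [Complex.ofReal_mul, Complex.ofReal_div, Complex.ofReal_pow, Complex.ofReal_ofNat]
  linear_combination ((Real.pi : ℂ) / 2 / (Real.sin (Real.pi * a) : ℂ)) * (((2 ^ a : ℝ) : ℂ) / 2 *
    besselSeries (1 - a) (((r : ℂ) / 2) ^ 2)) * (-e2')

/-- Only the `I_{-a}` term survives at `0`; the reflection formula for the Gamma function turns its
constant into the limit found for the integral. -/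
lemma tendsto_rpow_mul_besselKAux {a : ℝ} (ha : 0 < a) (ha1 : a < 1) :
    Tendsto (fun r : ℝ => ((r ^ a : ℝ) : ℂ) * besselKAux a r) (𝓝[>] 0)
      (𝓝 ((2 ^ a * Real.Gamma a / 2 : ℝ) : ℂ)) := by
  have hw : Continuous fun r : ℝ => (((r / 2) ^ 2 : ℝ) : ℂ) := by fun_prop
  have hpow : Continuous fun r : ℝ => ((2 ^ (-a) * r ^ (2 * a) : ℝ) : ℂ) :=
    Complex.continuous_ofReal.comp
      (continuous_const.mul (Real.continuous_rpow_const (by positivity)))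
  have hcont : Continuous fun r : ℝ => (Real.pi / 2 / Real.sin (Real.pi * a) : ℝ) *
      (((2 ^ a : ℝ) : ℂ) * besselSeries (-a) (((r / 2) ^ 2 : ℝ) : ℂ) -
        ((2 ^ (-a) * r ^ (2 * a) : ℝ) : ℂ) * besselSeries a (((r / 2) ^ 2 : ℝ) : ℂ)) :=
    continuous_const.mul ((continuous_const.mul ((continuous_besselSeries (-a)).comp hw)).sub
      (hpow.mul ((continuous_besselSeries a).comp hw)))
  have h := (hcont.tendsto 0).mono_left (nhdsWithin_le_nhds (s := Ioi 0))
  have heq : (fun r : ℝ => (Real.pi / 2 / Real.sin (Real.pi * a) : ℝ) *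
      (((2 ^ a : ℝ) : ℂ) * besselSeries (-a) (((r / 2) ^ 2 : ℝ) : ℂ) -
        ((2 ^ (-a) * r ^ (2 * a) : ℝ) : ℂ) * besselSeries a (((r / 2) ^ 2 : ℝ) : ℂ)))
      =ᶠ[𝓝[>] 0] fun r : ℝ => ((r ^ a : ℝ) : ℂ) * besselKAux a r := by
    filter_upwards [self_mem_nhdsWithin] with r hr using (rpow_mul_besselKAux_eq hr).symm
  refine (h.congr' heq).trans (le_of_eq ?_)
  congr 1
  have h0 : (0 : ℝ) ^ (2 * a) = 0 := Real.zero_rpow (by positivity)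
  have hw0 : (((0 / 2) ^ 2 : ℝ) : ℂ) = 0 := by simp
  have hg : (Complex.Gamma (((-a : ℝ) : ℂ) + 1)) = (Real.Gamma (1 - a) : ℂ) := by
    rw [← Complex.Gamma_ofReal]; congr 1; push_cast; ring
  rw [hw0, h0, mul_zero, Complex.ofReal_zero, zero_mul, sub_zero, besselSeries_zero, hg]
  have hrefl := Real.Gamma_mul_Gamma_one_sub a
  have hg1 : Real.Gamma (1 - a) ≠ 0 := (Real.Gamma_pos_of_pos (by linarith)).ne'
  have hs : Real.sin (Real.pi * a) ≠ 0 := by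
    refine (Real.sin_pos_of_pos_of_lt_pi (by positivity) ?_).ne'
    nlinarith [Real.pi_pos]
  norm_cast
  rw [eq_div_iff hs] at hrefl
  field_simp
  linear_combination -hrefl

/-- `K_a(x)` has the integral representation for `0 < a < 1` and `x > 0`. -/
lemma besselKAux_ofReal_eq_besselKInt {a x : ℝ} (ha : 0 < a) (ha1 : a < 1) (hx : 0 < x) :
    besselKAux a x = besselKInt a x := by
  have ha' : 0 < 1 - a := by linarith
  -- For `0 < a < 1` both exponents `2a - 1` and `1 - 2a` exceed `-1`, so the coefficients have an
  -- antiderivative `Φ` that tends to `0` at `0`.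
  have h := eq_zero_of_singular_linear_system (L := 0)
    (D := fun r : ℝ => ((r ^ a : ℝ) : ℂ) * besselKAux a r - ((r ^ a : ℝ) : ℂ) * besselKInt a r)
    (E := fun r : ℝ => ((r ^ (1 - a) : ℝ) : ℂ) * besselKAux (1 - a) r -
      ((r ^ (1 - a) : ℝ) : ℂ) * besselKInt (1 - a) r)
    (p := fun r => r ^ (2 * a - 1)) (q := fun r => r ^ (2 * (1 - a) - 1))
    (Φ := fun r => r ^ (2 * a) / (2 * a) + r ^ (2 * (1 - a)) / (2 * (1 - a)))
    (fun r hr => by positivity) (fun r hr => by positivity)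
    (fun r hr => ?_) (fun r hr => ?_) (fun r hr => ?_) ?_ ?_ ?_ hx
  · have hne : ((x ^ a : ℝ) : ℂ) ≠ 0 := by exact_mod_cast (Real.rpow_pos_of_pos hx a).ne'
    exact mul_left_cancel₀ hne (sub_eq_zero.1 h)
  · refine ((hasDerivAt_rpow_mul_besselKAux hr).sub
      (hasDerivAt_rpow_mul_besselKInt hr)).congr_deriv ?_
    ring
  · have := (hasDerivAt_rpow_mul_besselKAux (a := 1 - a) hr).sub
      (hasDerivAt_rpow_mul_besselKInt (a := 1 - a) hr)
    rw [sub_sub_cancel] at this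
    refine this.congr_deriv ?_
    ring
  · refine (((Real.hasDerivAt_rpow_const (p := 2 * a) (Or.inl hr.ne')).div_const (2 * a)).add
      ((Real.hasDerivAt_rpow_const (p := 2 * (1 - a)) (Or.inl hr.ne')).div_const
        (2 * (1 - a)))).congr_deriv ?_
    field_simp
  · have hc : Continuous fun r : ℝ =>
        r ^ (2 * a) / (2 * a) + r ^ (2 * (1 - a)) / (2 * (1 - a)) :=
      ((Real.continuous_rpow_const (by positivity)).div_const _).add
        ((Real.continuous_rpow_const (by positivity)).div_const _)
    have := (hc.tendsto 0).mono_left (nhdsWithin_le_nhds (s := Ioi 0))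
    rwa [Real.zero_rpow (by positivity), Real.zero_rpow (by positivity), zero_div, zero_div,
      add_zero] at this
  · simpa using (tendsto_rpow_mul_besselKAux ha ha1).sub (tendsto_rpow_mul_besselKInt ha)
  · simpa using (tendsto_rpow_mul_besselKAux ha' (by linarith)).sub
      (tendsto_rpow_mul_besselKInt ha')

lemma isOpen_re_pos : IsOpen {z : ℂ | 0 < z.re} := isOpen_lt continuous_const Complex.continuous_re

lemma differentiableAt_besselI (a : ℝ) {z : ℂ} (hz : 0 < z.re) :
    DifferentiableAt ℂ (besselI a) z := by
  have hne : ∀ w : ℂ, 0 < w.re → w ≠ 0 := by rintro w hw rfl; simp at hw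
  have heq : besselI a =ᶠ[𝓝 z] fun w => (w / 2) ^ (a : ℂ) * besselSeries a ((w / 2) ^ 2) := by
    filter_upwards [isOpen_re_pos.mem_nhds hz] with w hw using besselI_eq a (hne w hw)
  refine DifferentiableAt.congr_of_eventuallyEq ?_ heq
  have hd : DifferentiableAt ℂ (fun w : ℂ => w / 2) z := by fun_prop
  refine (hd.cpow_const ?_).mul ?_
  · left
    simpa using hz
  · exact ((hasDerivAt_besselSeries a _).differentiableAt.comp z (hd.pow 2))

/-- Both sides are holomorphic in the half plane and agree on the positive reals, which accumulate
at `1`. -/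
lemma besselKAux_eq_besselKInt_of_lt_one {a : ℝ} (ha : 0 < a) (ha1 : a < 1) {z : ℂ}
    (hz : 0 < z.re) : besselKAux a z = besselKInt a z := by
  have h1 : AnalyticOnNhd ℂ (besselKAux a) {z : ℂ | 0 < z.re} := by
    refine DifferentiableOn.analyticOnNhd (fun w hw => ?_) isOpen_re_pos
    exact ((((differentiableAt_besselI (-a) hw).sub
      (differentiableAt_besselI a hw)).div_const _).const_mul _).differentiableWithinAt
  have h2 : AnalyticOnNhd ℂ (besselKInt a) {z : ℂ | 0 < z.re} :=
    DifferentiableOn.analyticOnNhd (fun w hw =>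
      (hasDerivAt_besselKInt a hw).differentiableAt.differentiableWithinAt) isOpen_re_pos
  have hpre : IsPreconnected {z : ℂ | 0 < z.re} :=
    (convex_halfSpace_re_gt 0).isPreconnected
  refine h1.eqOn_of_preconnected_of_frequently_eq h2 hpre (z₀ := 1) (by simp) ?_ hz
  have hfreq : ∃ᶠ x : ℝ in 𝓝[>] 1, besselKAux a x = besselKInt a x := by
    refine Eventually.frequently ?_
    filter_upwards [self_mem_nhdsWithin] with x hx
    exact besselKAux_ofReal_eq_besselKInt ha ha1 (zero_lt_one.trans hx)
  have htend : Tendsto (fun x : ℝ => (x : ℂ)) (𝓝[>] 1) (𝓝[≠] 1) := by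
    refine tendsto_nhdsWithin_iff.2 ⟨?_, ?_⟩
    · have := (Complex.continuous_ofReal.tendsto 1).mono_left (nhdsWithin_le_nhds (s := Ioi 1))
      simpa using this
    · filter_upwards [self_mem_nhdsWithin] with x hx
      have hx : 1 < x := hx
      simpa using hx.ne'
  exact htend.frequently hfreq

/-- The integral representation of `K_a` in the right half plane for non-integral order. -/
lemma besselKAux_eq_besselKInt {a : ℝ} (ha : ¬∃ m : ℤ, (m : ℝ) = a) {z : ℂ} (hz : 0 < z.re) :
    besselKAux a z = besselKInt a z := by
  have hz0 : z ≠ 0 := by rintro rfl; simp at hz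
  -- The recurrence has two steps, so the induction carries a pair of consecutive orders. It starts
  -- at `b - 1` and `b`, where evenness moves `b - 1` to `1 - b ∈ (0, 1)`.
  have hladder : ∀ b : ℝ, 0 < b → b < 1 → ∀ k : ℕ,
      besselKAux (b + k - 1) z = besselKInt (b + k - 1) z ∧
        besselKAux (b + k) z = besselKInt (b + k) z := by
    intro b hb hb1 k
    induction k with
    | zero =>
      refine ⟨?_, ?_⟩
      · rw [Nat.cast_zero, add_zero, ← neg_sub, besselKAux_neg, besselKInt_neg]
        exact besselKAux_eq_besselKInt_of_lt_one (by linarith) (by linarith) hz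
      · rw [Nat.cast_zero, add_zero]
        exact besselKAux_eq_besselKInt_of_lt_one hb hb1 hz
    | succ k ih =>
      have e1 : b + (k + 1 : ℕ) - 1 = b + k := by push_cast; ring
      have e2 : b + (k + 1 : ℕ) = b + k + 1 := by push_cast; ring
      rw [e1, e2]
      refine ⟨ih.2, ?_⟩
      have h1 := besselKAux_add_one_sub (b + k) hz0
      have h2 := besselKInt_add_one_sub (b + k) hz
      rw [ih.1, ih.2, ← h2] at h1
      have h3 := mul_left_cancel₀ hz0 h1
      exact sub_left_inj.1 h3
  have hpos : ∀ b : ℝ, 0 < b → (¬∃ m : ℤ, (m : ℝ) = b) → besselKAux b z = besselKInt b z := by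
    intro b hb hbZ
    have hfr : 0 < Int.fract b := by
      refine (Int.fract_nonneg b).lt_of_ne' fun h => hbZ ?_
      rw [Int.fract_eq_zero_iff] at h
      exact h
    have h := (hladder (Int.fract b) hfr (Int.fract_lt_one b) ⌊b⌋₊).2
    rwa [natCast_floor_eq_intCast_floor hb.le, Int.fract_add_floor] at h
  rcases lt_trichotomy a 0 with h | h | h
  · rw [← besselKAux_neg, ← besselKInt_neg]
    refine hpos (-a) (by linarith) ?_
    rintro ⟨m, hm⟩
    exact ha ⟨-m, by push_cast; linarith⟩
  · exact absurd ⟨0, by simp [h]⟩ ha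
  · exact hpos a h ha

/-- The integral representation of `K_a` in the right half plane. -/
theorem besselK_eq_besselKInt (a : ℝ) {z : ℂ} (hz : 0 < z.re) :
    besselK a z = besselKInt a z := by
  unfold besselK
  split_ifs with h
  · obtain ⟨m, rfl⟩ := h
    refine Tendsto.limUnder_eq ?_
    have h1 := ((continuous_besselKInt_order hz).tendsto (m : ℝ)).mono_left
      (nhdsWithin_le_nhds (s := {(m : ℝ)}ᶜ))
    refine h1.congr' ?_
    -- No other integer lies this close to `m`, so the non-integral case covers the punctured
    -- neighbourhood.
    have h2 : Ioo ((m : ℝ) - 1) (m + 1) ∈ 𝓝[≠] (m : ℝ) :=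
      mem_nhdsWithin_of_mem_nhds (Ioo_mem_nhds (by linarith) (by linarith))
    filter_upwards [h2, self_mem_nhdsWithin] with b hb hbm
    refine (besselKAux_eq_besselKInt ?_ hz).symm
    rintro ⟨k, rfl⟩
    have h3 : m - 1 < k := by exact_mod_cast hb.1
    have h4 : k < m + 1 := by exact_mod_cast hb.2
    exact hbm (by rw [show k = m by omega]; rfl)
  · exact besselKAux_eq_besselKInt h hz

end BesselIdentity

/-! ### Pointwise bounds for the radial kernel. -/

section RadialKernel

/-- The profile `min (t ^ (-(n - 1/2)), t ^ (-(n + 1/2)))`, which is integrable on `ℝⁿ`. -/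
noncomputable def radialProfile (n : ℕ) (t : ℝ) : ℝ :=
  min (t ^ (-((n : ℝ) - 1 / 2))) (t ^ (-((n : ℝ) + 1 / 2)))

lemma radialProfile_antitoneOn (n : ℕ) [NeZero n] : AntitoneOn (radialProfile n) (Ioi 0) := by
  intro t ht u _ htu
  have hn : (1 : ℝ) ≤ n := by exact_mod_cast NeZero.one_le
  exact min_le_min (Real.rpow_le_rpow_of_nonpos ht htu (by linarith))
    (Real.rpow_le_rpow_of_nonpos ht htu (by linarith))

lemma radialProfile_le (n : ℕ) {t : ℝ} (ht : 0 < t) : radialProfile n t ≤ t ^ (-(n : ℝ)) := by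
  rcases le_total t 1 with h | h
  · exact (min_le_left _ _).trans (Real.rpow_le_rpow_of_exponent_ge ht h (by linarith))
  · exact (min_le_right _ _).trans (Real.rpow_le_rpow_of_exponent_le h (by linarith))

/-- A convention of `rpow`: negative powers of `0` are `0`, so points at distance `0` contribute
nothing to integrals of the profile. -/
lemma radialProfile_zero (n : ℕ) [NeZero n] : radialProfile n 0 = 0 := by
  have hn : (1 : ℝ) ≤ n := by exact_mod_cast NeZero.one_le
  unfold radialProfile
  rw [Real.zero_rpow (by linarith), Real.zero_rpow (by linarith), min_self]

lemma radialProfile_nonneg (n : ℕ) {t : ℝ} (ht : 0 ≤ t) : 0 ≤ radialProfile n t :=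
  le_min (Real.rpow_nonneg ht _) (Real.rpow_nonneg ht _)

/-- On a sector, `Re √λ` is bounded below by a multiple of `|√λ|`. -/
lemma exists_mul_rpow_half_le_re_sqrt {η : ℝ} (hη : 0 < η) :
    ∃ δ : ℝ, 0 < δ ∧ ∀ lam ∈ sector (Real.pi - η),
      δ * ‖lam‖ ^ (1 / 2 : ℝ) ≤ (lam ^ (1 / 2 : ℂ)).re := by
  by_cases hηπ : η < Real.pi
  · refine ⟨Real.sin (η / 2), Real.sin_pos_of_pos_of_lt_pi (by linarith) (by linarith),
      fun lam hlam => ?_⟩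
    have h1 : (lam ^ (1 / 2 : ℂ)).re =
        ‖lam‖ ^ (1 / 2 : ℝ) * Real.cos (lam.arg * (1 / 2 : ℝ)) := by
      rw [← Complex.cpow_ofReal_re]
      norm_num
    rw [h1, mul_comm]
    refine mul_le_mul_of_nonneg_left ?_ (by positivity)
    -- The argument of `√λ` is half of that of `λ`, hence at most `(π - η)/2` in absolute value.
    have h2 : Real.sin (η / 2) = Real.cos ((Real.pi - η) / 2) := by
      rw [← Real.cos_pi_div_two_sub]; congr 1; ring
    rw [h2, ← Real.cos_abs (lam.arg * (1 / 2))]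
    have h3 : |lam.arg * (1 / 2)| ≤ (Real.pi - η) / 2 := by
      rw [abs_mul, abs_of_pos (by norm_num : (0 : ℝ) < 1 / 2)]
      linarith [hlam.2]
    exact Real.cos_le_cos_of_nonneg_of_le_pi (abs_nonneg _) (by linarith [Real.pi_pos]) h3
  -- For `η ≥ π` the sector is empty.
  · refine ⟨1, one_pos, fun lam hlam => ?_⟩
    have := hlam.2
    linarith [abs_nonneg lam.arg]

lemma exists_norm_radialKernel_le (n : ℕ) [NeZero n] {η : ℝ} (hη : 0 < η) :
    ∃ C : ℝ, 0 < C ∧ ∀ lam ∈ sector (Real.pi - η), ∀ r : ℝ, 0 < r →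
      ‖radialKernel n lam r‖ ≤ C * (‖lam‖ ^ (1 / 2 : ℝ)) ^ ((n : ℝ) - 2) *
        radialProfile n (‖lam‖ ^ (1 / 2 : ℝ) * r) := by
  have hn : (1 : ℝ) ≤ n := by exact_mod_cast NeZero.one_le
  obtain ⟨δ, hδ, hre⟩ := exists_mul_rpow_half_le_re_sqrt hη
  set ν : ℝ := (n : ℝ) / 2 - 1 with hν
  have key : ∀ b : ℝ, 0 < b → 0 < ν + b → ∃ C : ℝ, 0 < C ∧ ∀ lam ∈ sector (Real.pi - η),
      ∀ r : ℝ, 0 < r → ‖radialKernel n lam r‖ ≤ C * (‖lam‖ ^ (1 / 2 : ℝ)) ^ ((n : ℝ) - 2) *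
        (‖lam‖ ^ (1 / 2 : ℝ) * r) ^ (-((n : ℝ) - 2 + 2 * b)) := by
    intro b hb hνb
    obtain ⟨C, hC, hbound⟩ := exists_norm_besselKInt_le hb hνb
    refine ⟨C * δ ^ (-(ν + 2 * b)), by positivity, fun lam hlam r hr => ?_⟩
    set s : ℝ := ‖lam‖ ^ (1 / 2 : ℝ) with hs
    have hs0 : 0 < s := Real.rpow_pos_of_pos (norm_pos_iff.2 hlam.1) _
    have hsnorm : ‖lam ^ (1 / 2 : ℂ)‖ = s := by
      rw [hs, ← Complex.norm_cpow_real]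
      norm_num
    have hzre : (lam ^ (1 / 2 : ℂ) * (r : ℂ)).re = (lam ^ (1 / 2 : ℂ)).re * r := by simp
    have hzle : δ * (s * r) ≤ (lam ^ (1 / 2 : ℂ) * (r : ℂ)).re := by
      rw [hzre, ← mul_assoc]
      exact mul_le_mul_of_nonneg_right (hre lam hlam) hr.le
    have hpos : 0 < δ * (s * r) := by positivity
    have hz : 0 < (lam ^ (1 / 2 : ℂ) * (r : ℂ)).re := hpos.trans_le hzle
    have hK : ‖besselK ν (lam ^ (1 / 2 : ℂ) * (r : ℂ))‖ ≤
        C * (δ * (s * r)) ^ (-(ν + 2 * b)) := by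
      rw [besselK_eq_besselKInt _ hz]
      exact (hbound _ hz).trans (mul_le_mul_of_nonneg_left
        (Real.rpow_le_rpow_of_nonpos hpos hzle (by linarith)) hC.le)
    have hfac : (1 : ℝ) ≤ Real.sqrt (2 * Real.pi) ^ n := by
      refine one_le_pow₀ (Real.one_le_sqrt.2 ?_)
      linarith [Real.pi_gt_three]
    have hrν : 0 < r ^ ν := Real.rpow_pos_of_pos hr _
    unfold radialKernel
    rw [norm_mul, norm_div, norm_div, Complex.norm_cpow_real, hsnorm, Complex.norm_real,
      Complex.norm_real, Real.norm_of_nonneg (by positivity), Real.norm_of_nonneg hrν.le]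
    calc s ^ ν / Real.sqrt (2 * Real.pi) ^ n *
          (‖besselK ν (lam ^ (1 / 2 : ℂ) * (r : ℂ))‖ / r ^ ν)
        ≤ s ^ ν * (C * (δ * (s * r)) ^ (-(ν + 2 * b)) / r ^ ν) := by
          gcongr
          exact div_le_self (by positivity) hfac
      _ = C * δ ^ (-(ν + 2 * b)) * s ^ ((n : ℝ) - 2) * (s * r) ^ (-((n : ℝ) - 2 + 2 * b)) := by
          have e1 : s ^ ((n : ℝ) - 2) = s ^ ν * s ^ ν := by
            rw [← Real.rpow_add hs0]; congr 1; rw [hν]; ring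
          have e2 : (s * r) ^ (-((n : ℝ) - 2 + 2 * b)) =
              (s * r) ^ (-(ν + 2 * b)) * (s ^ (-ν) * r ^ (-ν)) := by
            rw [← Real.mul_rpow hs0.le hr.le, ← Real.rpow_add (by positivity)]
            congr 1; rw [hν]; ring
          have e3 : s ^ ν * s ^ (-ν) = 1 := by
            rw [← Real.rpow_add hs0, add_neg_cancel, Real.rpow_zero]
          rw [Real.mul_rpow hδ.le (by positivity), e1, e2, Real.rpow_neg hr.le ν, div_eq_mul_inv]
          linear_combination (-s ^ ν * C * δ ^ (-(ν + 2 * b)) * (s * r) ^ (-(ν + 2 * b)) *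
            (r ^ ν)⁻¹) * e3
  -- The exponent `n - 2 + 2b` becomes `n - 1/2` for `b = 3/4` and `n + 1/2` for `b = 5/4`, one on
  -- each side of `n`. Both values satisfy `ν + b > 0`, since `ν ≥ -1/2`.
  obtain ⟨C₁, hC₁, h₁⟩ := key (3 / 4) (by norm_num) (by rw [hν]; linarith)
  obtain ⟨C₂, hC₂, h₂⟩ := key (5 / 4) (by norm_num) (by rw [hν]; linarith)
  refine ⟨max C₁ C₂, lt_max_of_lt_left hC₁, fun lam hlam r hr => ?_⟩
  have hs0 : 0 < ‖lam‖ ^ (1 / 2 : ℝ) := Real.rpow_pos_of_pos (norm_pos_iff.2 hlam.1) _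
  unfold radialProfile
  rw [mul_min_of_nonneg _ _ (by positivity)]
  refine le_min ?_ ?_
  · refine (h₁ lam hlam r hr).trans ?_
    rw [show (n : ℝ) - 2 + 2 * (3 / 4) = n - 1 / 2 by ring]
    gcongr
    exact le_max_left _ _
  · refine (h₂ lam hlam r hr).trans ?_
    rw [show (n : ℝ) - 2 + 2 * (5 / 4) = n + 1 / 2 by ring]
    gcongr
    exact le_max_right _ _

/-- Serves the measurability of the kernel; continuity comes from the integral representation. -/
lemma continuousOn_radialKernel (n : ℕ) {lam : ℂ} (hlam : 0 < (lam ^ (1 / 2 : ℂ)).re) :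
    ContinuousOn (radialKernel n lam) (Ioi 0) := by
  have hre : ∀ r : ℝ, 0 < r → 0 < (lam ^ (1 / 2 : ℂ) * (r : ℂ)).re := fun r hr => by
    simpa using mul_pos hlam hr
  have hK : ContinuousOn (fun r : ℝ => besselK ((n : ℝ) / 2 - 1) (lam ^ (1 / 2 : ℂ) * (r : ℂ)))
      (Ioi 0) := by
    refine ContinuousOn.congr (f := fun r : ℝ =>
      besselKInt ((n : ℝ) / 2 - 1) (lam ^ (1 / 2 : ℂ) * (r : ℂ))) (fun r hr => ?_)
      fun r hr => besselK_eq_besselKInt _ (hre r hr)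
    refine ContinuousAt.continuousWithinAt ?_
    exact ContinuousAt.comp (f := fun r : ℝ => lam ^ (1 / 2 : ℂ) * (r : ℂ))
      (hasDerivAt_besselKInt _ (hre r hr)).continuousAt (by fun_prop)
  refine continuousOn_const.mul (hK.div ?_ fun r hr => ?_)
  · exact Complex.continuous_ofReal.comp_continuousOn
      (continuousOn_id.rpow_const fun r hr => Or.inl (ne_of_gt hr))
  · exact_mod_cast (Real.rpow_pos_of_pos hr _).ne'

end RadialKernel

/-! ### Integration over dyadic shells. -/

section DyadicIntegral
open scoped NNReal

/-- Both exponents of the profile differ from `n` by `1/2`; the better one gains `2^(-|k|/2)` over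
`t^(-n)` on either side of `t = 1`. -/
lemma radialProfile_two_zpow_le (n : ℕ) (k : ℤ) :
    radialProfile n ((2 : ℝ) ^ k) ≤
      ((2 : ℝ) ^ k) ^ (-(n : ℝ)) * ((2 : ℝ) ^ (-(1 / 2) : ℝ)) ^ k.natAbs := by
  have h2 : (0 : ℝ) < 2 ^ k := by positivity
  have hθ : ((2 : ℝ) ^ (-(1 / 2) : ℝ)) ^ k.natAbs = 2 ^ (-(1 / 2) * (k.natAbs : ℝ) : ℝ) := by
    rw [Real.rpow_mul zero_le_two, Real.rpow_natCast]
  rw [hθ, ← Real.rpow_intCast 2 k, ← Real.rpow_mul zero_le_two, ← Real.rpow_add two_pos]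
  unfold radialProfile
  rw [← Real.rpow_mul zero_le_two, ← Real.rpow_mul zero_le_two]
  have habs : (k.natAbs : ℝ) = |(k : ℝ)| := by rw [Nat.cast_natAbs, Int.cast_abs]
  rw [habs]
  rcases le_total 0 (k : ℝ) with hk | hk
  · refine (min_le_right _ _).trans (Real.rpow_le_rpow_of_exponent_le one_le_two ?_)
    rw [abs_of_nonneg hk]
    linarith
  · refine (min_le_left _ _).trans (Real.rpow_le_rpow_of_exponent_le one_le_two ?_)
    rw [abs_of_nonpos hk]
    linarith

lemma summable_pow_natAbs {θ : ℝ} (h0 : 0 ≤ θ) (h1 : θ < 1) :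
    Summable fun k : ℤ => θ ^ k.natAbs := by
  refine Summable.of_nat_of_neg ?_ ?_ <;> simpa using summable_geometric_of_lt_one h0 h1

/-- If `μ {δ < r} ≤ A r ^ n`, then the integral of the profile of `s δ` is bounded by a multiple of
`s ^ (-n)`. -/
lemma exists_lintegral_radialProfile_le (n : ℕ) [NeZero n] (A : ℝ≥0)
    {X : Type*} [MeasurableSpace X] (μ : Measure X) :
    ∃ A' : ℝ≥0, ∀ δ : X → ℝ≥0∞, Measurable δ →
      (∀ r : ℝ≥0, μ {x | δ x < r} ≤ A * (r : ℝ≥0∞) ^ n) → ∀ s : ℝ, 0 < s →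
      ∫⁻ x, (if δ x = ⊤ then 0 else ENNReal.ofReal (radialProfile n (s * (δ x).toReal))) ∂μ ≤
        A' * ENNReal.ofReal (s ^ (-(n : ℝ))) := by
  set θ : ℝ := (2 : ℝ) ^ (-(1 / 2) : ℝ) with hθ
  have hθ0 : 0 ≤ θ := by positivity
  have hθ1 : θ < 1 := Real.rpow_lt_one_of_one_lt_of_neg one_lt_two (by norm_num)
  have hsum := summable_pow_natAbs hθ0 hθ1
  set T : ℝ≥0∞ := ∑' k : ℤ, ENNReal.ofReal (θ ^ k.natAbs) with hT
  have hTtop : T ≠ ⊤ := hsum.tsum_ofReal_ne_top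
  refine ⟨A * 2 ^ n * T.toNNReal, fun δ hδ hμ s hs => ?_⟩
  have hmeas : ∀ k : ℤ, MeasurableSet {x | δ x < ((2 ^ (k + 1) / s).toNNReal : ℝ≥0)} := fun k =>
    measurableSet_lt hδ measurable_const
  -- If `2^k ≤ s δ(x) < 2^(k+1)`, monotonicity bounds the profile by its value at `2^k`, and the
  -- shell lies in the ball of its outer radius.
  have hpt : ∀ x, (if δ x = ⊤ then 0 else
      ENNReal.ofReal (radialProfile n (s * (δ x).toReal))) ≤
      ∑' k : ℤ, ({x | δ x < ((2 ^ (k + 1) / s).toNNReal : ℝ≥0)}).indicator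
        (fun _ => ENNReal.ofReal (radialProfile n (2 ^ k))) x := by
    intro x
    split_ifs with hx
    · exact zero_le
    by_cases hx0 : δ x = 0
    · rw [hx0, ENNReal.toReal_zero, mul_zero, radialProfile_zero, ENNReal.ofReal_zero]
      exact zero_le
    have hd : 0 < (δ x).toReal := ENNReal.toReal_pos hx0 hx
    have ht : 0 < s * (δ x).toReal := mul_pos hs hd
    obtain ⟨k, hk⟩ := exists_mem_Ico_zpow ht one_lt_two
    refine le_trans ?_ (ENNReal.le_tsum k)
    have hmem : δ x < ((2 ^ (k + 1) / s).toNNReal : ℝ≥0) := by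
      rw [← ENNReal.ofReal, ENNReal.lt_ofReal_iff_toReal_lt hx, lt_div_iff₀ hs, mul_comm]
      exact hk.2
    rw [indicator_of_mem (by exact hmem)]
    refine ENNReal.ofReal_le_ofReal ?_
    exact radialProfile_antitoneOn n (show (0 : ℝ) < 2 ^ k by positivity) ht hk.1
  -- The factor `2^(kn)` from the ball cancels the `n`-th power decay of the profile; the geometric
  -- factor `θ^|k|` is left.
  have hterm : ∀ k : ℤ, ENNReal.ofReal (radialProfile n (2 ^ k)) *
      μ {x | δ x < ((2 ^ (k + 1) / s).toNNReal : ℝ≥0)} ≤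
      A * 2 ^ n * ENNReal.ofReal (s ^ (-(n : ℝ))) * ENNReal.ofReal (θ ^ k.natAbs) := by
    intro k
    have h2k : (0 : ℝ) < 2 ^ k := by positivity
    have h1 : ((2 ^ (k + 1) / s).toNNReal : ℝ≥0∞) ^ n =
        2 ^ n * (ENNReal.ofReal (s ^ (-(n : ℝ))) * ENNReal.ofReal ((2 ^ k) ^ (n : ℝ))) := by
      have e : (2 ^ (k + 1) / s : ℝ) ^ n = 2 ^ n * (s ^ (-(n : ℝ)) * (2 ^ k) ^ (n : ℝ)) := by
        rw [Real.rpow_neg hs.le, Real.rpow_natCast, Real.rpow_natCast, zpow_add_one₀ two_ne_zero,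
          div_pow, mul_pow]
        field_simp
      change (ENNReal.ofReal (2 ^ (k + 1) / s)) ^ n = _
      rw [← ENNReal.ofReal_pow (by positivity), e, ENNReal.ofReal_mul (by positivity),
        ENNReal.ofReal_mul (by positivity), ENNReal.ofReal_pow zero_le_two]
      norm_num
    have h3 : ENNReal.ofReal (radialProfile n (2 ^ k)) * ENNReal.ofReal ((2 ^ k) ^ (n : ℝ)) ≤
        ENNReal.ofReal (θ ^ k.natAbs) := by
      rw [← ENNReal.ofReal_mul (radialProfile_nonneg n h2k.le)]
      refine ENNReal.ofReal_le_ofReal ?_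
      refine (mul_le_mul_of_nonneg_right (radialProfile_two_zpow_le n k)
        (by positivity)).trans_eq ?_
      rw [Real.rpow_neg h2k.le, ← hθ]
      have : ((2 : ℝ) ^ k) ^ (n : ℝ) ≠ 0 := (Real.rpow_pos_of_pos h2k _).ne'
      field_simp
    calc _ ≤ ENNReal.ofReal (radialProfile n (2 ^ k)) *
          (A * ((2 ^ (k + 1) / s).toNNReal : ℝ≥0∞) ^ n) := by gcongr; exact hμ _
      _ = A * 2 ^ n * ENNReal.ofReal (s ^ (-(n : ℝ))) *
          (ENNReal.ofReal (radialProfile n (2 ^ k)) * ENNReal.ofReal ((2 ^ k) ^ (n : ℝ))) := by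
        rw [h1]; ring
      _ ≤ _ := by gcongr
  calc _ ≤ ∫⁻ x, ∑' k : ℤ, ({x | δ x < ((2 ^ (k + 1) / s).toNNReal : ℝ≥0)}).indicator
        (fun _ => ENNReal.ofReal (radialProfile n (2 ^ k))) x ∂μ := lintegral_mono hpt
    _ = ∑' k : ℤ, ENNReal.ofReal (radialProfile n (2 ^ k)) *
        μ {x | δ x < ((2 ^ (k + 1) / s).toNNReal : ℝ≥0)} := by
      rw [lintegral_tsum fun k => (measurable_const.indicator (hmeas k)).aemeasurable]
      congr 1
      ext k
      rw [lintegral_indicator_const (hmeas k)]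
    _ ≤ ∑' k : ℤ, A * 2 ^ n * ENNReal.ofReal (s ^ (-(n : ℝ))) * ENNReal.ofReal (θ ^ k.natAbs) :=
      ENNReal.tsum_le_tsum hterm
    _ = (A * 2 ^ n * T.toNNReal : ℝ≥0) * ENNReal.ofReal (s ^ (-(n : ℝ))) := by
      rw [ENNReal.tsum_mul_left, ← hT]
      push_cast [ENNReal.coe_toNNReal hTtop]
      ring

end DyadicIntegral

/-! ### The smoothed distance. -/

section SmoothedDistance

/-- The smoothed distance is a convex combination of `s` and `2ε`. -/
lemma IsCutoff.min_le_smoothedDist {χ : ℝ → ℝ} (hχ : IsCutoff χ) (ε : ℝ)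
    {s : ℝ≥0∞} (hs : s ≠ ⊤) : min s.toReal (2 * ε) ≤ smoothedDist ε χ s := by
  unfold smoothedDist
  rw [if_neg hs]
  have h := hχ.mem_Icc (s.toReal / ε)
  have h1 := mul_le_mul_of_nonneg_right (min_le_left s.toReal (2 * ε)) h.1
  have h2 := mul_le_mul_of_nonneg_right (min_le_right s.toReal (2 * ε)) (sub_nonneg.2 h.2)
  linarith

lemma smoothedDist_top (ε : ℝ) (χ : ℝ → ℝ) : smoothedDist ε χ ⊤ = 2 * ε := if_pos rfl

/-- The only delicate point is `⊤`: the function is constantly `2ε` beyond `2ε`, which is also its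
value there. -/
lemma continuous_smoothedDist {χ : ℝ → ℝ} (hχ : IsCutoff χ) {ε : ℝ} (hε : 0 < ε) :
    Continuous (smoothedDist ε χ) := by
  have hc : Continuous fun t : ℝ => t * χ (t / ε) + 2 * ε * (1 - χ (t / ε)) := by
    have := hχ.contDiff.continuous
    fun_prop
  refine continuous_iff_continuousAt.2 fun s => ?_
  by_cases hs : s = ⊤
  · subst hs
    refine (continuousAt_const (y := 2 * ε)).congr ?_
    filter_upwards [lt_mem_nhds (ENNReal.ofReal_lt_top (r := 2 * ε))] with t ht
    by_cases ht' : t = ⊤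
    · rw [ht', smoothedDist_top]
    · have h2 : 2 < t.toReal / ε := by
        rw [lt_div_iff₀ hε]
        exact (ENNReal.ofReal_lt_iff_lt_toReal (by positivity) ht').1 ht
      unfold smoothedDist
      rw [if_neg ht', hχ.eq_zero _ h2]
      ring
  · refine (hc.continuousAt.comp (ENNReal.continuousAt_toReal hs)).congr ?_
    filter_upwards [isOpen_ne.mem_nhds hs] with t ht
    exact (if_neg ht).symm

end SmoothedDistance

/-! ### The uniform L¹ bound for the kernel. -/

section KernelBound
open scoped NNReal

variable {n : ℕ} [NeZero n]
  {M : Type*} [EMetricSpace M] [ChartedSpace (EuclideanHalfSpace n) M]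
  [RiemannianBundle (fun x : M => TangentSpace (𝓡∂ n) x)]
  {N : Type*} [EMetricSpace N] [ChartedSpace (EuclideanSpace ℝ (Fin n)) N]
  [RiemannianBundle (fun x : N => TangentSpace (𝓡 n) x)]

lemma IsRiemannianExtension.norm_mfderiv {ι : M → N} (hι : IsRiemannianExtension (n := n) ι)
    (x : M) (v : TangentSpace (𝓡∂ n) x) : ‖mfderiv (𝓡∂ n) (𝓡 n) ι x v‖ = ‖v‖ := by
  rw [norm_eq_sqrt_real_inner, norm_eq_sqrt_real_inner, hι.inner_eq]

lemma IsRiemannianExtension.mfderiv_injective {ι : M → N}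
    (hι : IsRiemannianExtension (n := n) ι) (x : M) :
    Function.Injective (mfderiv (𝓡∂ n) (𝓡 n) ι x) := by
  refine (injective_iff_map_eq_zero _).2 fun v hv => ?_
  rw [← norm_eq_zero, ← hι.norm_mfderiv, hv, norm_zero]

variable [IsRiemannianManifold (𝓡∂ n) M] [IsRiemannianManifold (𝓡 n) N]

/-- The differential preserves norms, so paths in `M` keep their length in `N`. Only an inequality
results, as `N` may offer shortcuts outside `M`. -/
lemma IsRiemannianExtension.edist_le {ι : M → N} (hι : IsRiemannianExtension (n := n) ι)
    (x y : M) : edist (ι x) (ι y) ≤ edist x y := by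
  refine edist_map_le_of_enorm_mfderiv_le (𝓡∂ n) (𝓡 n) (hι.contMDiff.of_le (by simp))
    (fun z v => ?_) x y
  rw [← ofReal_norm, ← ofReal_norm, hι.norm_mfderiv]

/-- The extended smoothed distance is continuous in the second variable and bounded below by the
truncated distance of `N`. -/
lemma IsSmoothedDistExtension.exists_le {ι : M → N} (hι : IsRiemannianExtension (n := n) ι)
    {ε : ℝ} (hε : 0 < ε) {χ : ℝ → ℝ} (hχ : IsCutoff χ) {ρ' : N → N → ℝ}
    (hρ' : IsSmoothedDistExtension ε χ ι ρ') :
    (∀ p, Continuous fun y => ρ' p (ι y)) ∧ ∃ c : ℝ, 0 < c ∧ ∀ p y,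
      (edist p (ι y) = ⊤ → c * (2 * ε) ≤ ρ' p (ι y)) ∧
      (edist p (ι y) ≠ ⊤ → c * min (edist p (ι y)).toReal (2 * ε) ≤ ρ' p (ι y)) := by
  refine ⟨fun p => ?_, ?_⟩
  · by_cases hp : p ∈ range ι
    · obtain ⟨x, rfl⟩ := hp
      simp only [hρ'.extends_rho]
      exact (continuous_smoothedDist hχ hε).comp (continuous_const.edist continuous_id)
    · exact hρ'.continuous_right p hp
  obtain ⟨c, hc, hcomp⟩ := hρ'.comparable
  -- The constant `1` serves points of `M`, and `c` serves the others.
  refine ⟨min c 1, lt_min hc one_pos, fun p y => ?_⟩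
  have hmin0 : ∀ t : ℝ, 0 ≤ t → 0 ≤ min t (2 * ε) := fun t ht => le_min ht (by positivity)
  by_cases hp : p ∈ range ι
  · obtain ⟨x, rfl⟩ := hp
    rw [hρ'.extends_rho]
    have hle := hι.edist_le x y
    refine ⟨fun h => ?_, fun h => ?_⟩
    · rw [h, top_le_iff] at hle
      rw [hle, smoothedDist_top]
      exact mul_le_of_le_one_left (by positivity) (min_le_right _ _)
    · refine (mul_le_of_le_one_left (hmin0 _ ENNReal.toReal_nonneg) (min_le_right _ _)).trans ?_
      by_cases hxy : edist x y = ⊤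
      · rw [hxy, smoothedDist_top]
        exact min_le_right _ _
      · refine le_trans ?_ (hχ.min_le_smoothedDist ε hxy)
        exact min_le_min_right _ (ENNReal.toReal_mono hxy hle)
  · have h1 := hcomp p hp y
    refine ⟨fun h => ?_, fun h => ?_⟩
    · rw [h, smoothedDist_top] at h1
      exact (mul_le_mul_of_nonneg_right (min_le_left _ _) (by positivity)).trans h1
    · have h2 := hχ.min_le_smoothedDist ε h
      refine le_trans ?_ h1
      exact mul_le_mul (min_le_left _ _) h2 (hmin0 _ ENNReal.toReal_nonneg) hc.le

variable [CompactSpace M] [MeasurableSpace M] [BorelSpace M] [IsManifold (𝓡∂ n) ∞ M]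
  [IsContMDiffRiemannianBundle (𝓡∂ n) ∞ (EuclideanSpace ℝ (Fin n))
    (fun x : M => TangentSpace (𝓡∂ n) x)]
  [IsManifold (𝓡 n) ∞ N]
  [IsContMDiffRiemannianBundle (𝓡 n) ∞ (EuclideanSpace ℝ (Fin n))
    (fun x : N => TangentSpace (𝓡 n) x)]

/-- The integrals `∫ |k_λ(ρ'(p, y))| dy` are bounded by a multiple of `1 / |λ|`, uniformly
in `p ∈ N`. -/
lemma exists_lintegral_radialKernel_le {ι : M → N} (hι : IsRiemannianExtension (n := n) ι)
    {ε : ℝ} (hε : 0 < ε) {χ : ℝ → ℝ} (hχ : IsCutoff χ) {ρ' : N → N → ℝ}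
    (hρ' : IsSmoothedDistExtension ε χ ι ρ') {η : ℝ} (hη : 0 < η) :
    ∃ C : ℝ, 0 < C ∧ ∀ lam ∈ sector (Real.pi - η), ∀ p : N,
      AEStronglyMeasurable (fun y => radialKernel n lam (ρ' p (ι y))) (riemannianVolume n M) ∧
      ∫⁻ y, ‖radialKernel n lam (ρ' p (ι y))‖ₑ ∂(riemannianVolume n M) ≤
        ENNReal.ofReal (C / ‖lam‖) := by
  have hn : n ≠ 0 := NeZero.ne n
  have hι1 : ContMDiff (𝓡∂ n) (𝓡 n) 1 ι := hι.contMDiff.of_le (by simp)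
  set μ := riemannianVolume n M with hμ
  obtain ⟨A, hA⟩ := exists_riemannianVolume_ball_le hι1 hι.isEmbedding.injective
    hι.mfderiv_injective
  obtain ⟨A', hA'⟩ := exists_lintegral_radialProfile_le n A μ
  obtain ⟨C, hC, hkernel⟩ := exists_norm_radialKernel_le n hη
  obtain ⟨δ, hδ, hre⟩ := exists_mul_rpow_half_le_re_sqrt hη
  obtain ⟨hcont, c, hc, hlow⟩ := hρ'.exists_le hι hε hχ
  -- Distances may be infinite, so one ball need not cover `M`; unit balls and compactness suffice.
  have hfin : μ univ ≠ ⊤ := by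
    refine (isCompact_univ.measure_lt_top_of_nhdsWithin fun x _ => ?_).ne
    refine ⟨{y | edist (ι x) (ι y) < (1 : ℝ≥0)}, mem_nhdsWithin_of_mem_nhds ?_, ?_⟩
    · refine (isOpen_lt (continuous_const.edist hι1.continuous) continuous_const).mem_nhds ?_
      simp
    · refine (hA (ι x) 1).trans_lt ?_
      simp
  -- Let `r → 0` in the volume bound, with `n ≥ 1`: the singular point of the kernel is negligible.
  have hnull : ∀ p : N, ∀ᵐ y ∂μ, edist p (ι y) ≠ 0 := by
    intro p
    refine ae_iff.2 (le_antisymm ?_ zero_le)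
    have hlim : Tendsto (fun r : ℝ≥0 => ((A * r ^ n : ℝ≥0) : ℝ≥0∞)) (𝓝[>] 0) (𝓝 0) := by
      have hc : Continuous fun r : ℝ≥0 => ((A * r ^ n : ℝ≥0) : ℝ≥0∞) :=
        ENNReal.continuous_coe.comp (by fun_prop)
      have := (hc.tendsto 0).mono_left (nhdsWithin_le_nhds (s := Ioi 0))
      simpa [hn] using this
    refine ge_of_tendsto hlim ?_
    filter_upwards [self_mem_nhdsWithin] with r hr
    refine (measure_mono fun y hy => ?_).trans ((hA p r).trans_eq (by push_cast; rfl))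
    have hy0 : edist p (ι y) = 0 := not_not.1 hy
    simpa [hy0] using hr
  set V : ℝ := (μ univ).toReal with hV
  -- The two summands come from the near part and from the part where `ρ' ≥ 2cε`. The `1` ensures
  -- positivity when `A'` and `V` vanish.
  refine ⟨C * (A' * c ^ (-(n : ℝ)) + (c * (2 * ε)) ^ (-(n : ℝ)) * V) + 1, by positivity,
    fun lam hlam p => ?_⟩
  have hlam0 : 0 < ‖lam‖ := norm_pos_iff.2 hlam.1
  set s : ℝ := ‖lam‖ ^ (1 / 2 : ℝ) with hs
  have hs0 : 0 < s := Real.rpow_pos_of_pos hlam0 _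
  have hρpos : ∀ y, edist p (ι y) ≠ 0 → 0 < ρ' p (ι y) := by
    intro y hy
    by_cases htop : edist p (ι y) = ⊤
    · exact lt_of_lt_of_le (by positivity) ((hlow p y).1 htop)
    · have := ENNReal.toReal_pos hy htop
      exact lt_of_lt_of_le (by positivity) ((hlow p y).2 htop)
  refine ⟨?_, ?_⟩
  · have hopen : IsOpen {y | 0 < ρ' p (ι y)} := isOpen_lt continuous_const (hcont p)
    have hon : ContinuousOn (fun y => radialKernel n lam (ρ' p (ι y))) {y | 0 < ρ' p (ι y)} :=
      (continuousOn_radialKernel n (lt_of_lt_of_le (by positivity) (hre lam hlam))).comp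
        (hcont p).continuousOn fun y hy => hy
    have hm := hon.aestronglyMeasurable (μ := μ) hopen.measurableSet
    rwa [Measure.restrict_eq_self_of_ae_mem] at hm
    filter_upwards [hnull p] with y hy using hρpos y hy
  set δ' : M → ℝ≥0∞ := fun y => edist p (ι y) with hδ'
  have hδm : Measurable δ' := (continuous_const.edist hι1.continuous).measurable
  have hsc : 0 < s * c := mul_pos hs0 hc
  have hpt : ∀ᵐ y ∂μ, ‖radialKernel n lam (ρ' p (ι y))‖ₑ ≤
      ENNReal.ofReal (C * s ^ ((n : ℝ) - 2)) * ((if δ' y = ⊤ then 0 else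
        ENNReal.ofReal (radialProfile n (s * c * (δ' y).toReal))) +
        ENNReal.ofReal ((s * c * (2 * ε)) ^ (-(n : ℝ)))) := by
    filter_upwards [hnull p] with y hy
    have hρ := hρpos y hy
    rw [← ofReal_norm]
    refine (ENNReal.ofReal_le_ofReal (hkernel lam hlam _ hρ)).trans ?_
    rw [ENNReal.ofReal_mul (by positivity)]
    gcongr
    have hε' : 0 < s * c * (2 * ε) := by positivity
    have hprof : ∀ t : ℝ, 0 < t → c * t ≤ ρ' p (ι y) →
        radialProfile n (s * ρ' p (ι y)) ≤ radialProfile n (s * c * t) := by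
      intro t ht hle
      refine radialProfile_antitoneOn n (mul_pos hsc ht) (mul_pos hs0 hρ) ?_
      rw [mul_assoc]
      gcongr
    have hfar : c * (2 * ε) ≤ ρ' p (ι y) →
        radialProfile n (s * ρ' p (ι y)) ≤ (s * c * (2 * ε)) ^ (-(n : ℝ)) := fun hle =>
      (hprof _ (by positivity) hle).trans (radialProfile_le n hε')
    by_cases htop : edist p (ι y) = ⊤
    · exact le_add_left (ENNReal.ofReal_le_ofReal (hfar ((hlow p y).1 htop)))
    · have hd := ENNReal.toReal_pos hy htop
      have hle := (hlow p y).2 htop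
      rcases min_cases (edist p (ι y)).toReal (2 * ε) with h | h
      · rw [h.1] at hle
        refine le_add_right ?_
        rw [if_neg htop]
        exact ENNReal.ofReal_le_ofReal (hprof _ hd hle)
      · rw [h.1] at hle
        exact le_add_left (ENNReal.ofReal_le_ofReal (hfar hle))
  have hVeq : μ univ = ENNReal.ofReal V := (ENNReal.ofReal_toReal hfin).symm
  have hV0 : 0 ≤ V := ENNReal.toReal_nonneg
  calc ∫⁻ y, ‖radialKernel n lam (ρ' p (ι y))‖ₑ ∂μ
      ≤ ∫⁻ y, ENNReal.ofReal (C * s ^ ((n : ℝ) - 2)) * ((if δ' y = ⊤ then 0 else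
        ENNReal.ofReal (radialProfile n (s * c * (δ' y).toReal))) +
        ENNReal.ofReal ((s * c * (2 * ε)) ^ (-(n : ℝ)))) ∂μ := lintegral_mono_ae hpt
    _ = ENNReal.ofReal (C * s ^ ((n : ℝ) - 2)) * ((∫⁻ y, (if δ' y = ⊤ then 0 else
        ENNReal.ofReal (radialProfile n (s * c * (δ' y).toReal))) ∂μ) +
        ENNReal.ofReal ((s * c * (2 * ε)) ^ (-(n : ℝ))) * μ univ) := by
      rw [lintegral_const_mul' _ _ ENNReal.ofReal_ne_top, lintegral_add_right _ measurable_const,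
        lintegral_const]
    _ ≤ ENNReal.ofReal (C * s ^ ((n : ℝ) - 2)) * (A' * ENNReal.ofReal ((s * c) ^ (-(n : ℝ))) +
        ENNReal.ofReal ((s * c * (2 * ε)) ^ (-(n : ℝ))) * μ univ) := by
      gcongr
      exact hA' δ' hδm (hA p) _ hsc
    _ = ENNReal.ofReal (C * s ^ ((n : ℝ) - 2) * (A' * (s * c) ^ (-(n : ℝ)) +
        (s * c * (2 * ε)) ^ (-(n : ℝ)) * V)) := by
      rw [hVeq, ENNReal.ofReal_mul (p := C * s ^ ((n : ℝ) - 2)) (by positivity),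
        ENNReal.ofReal_add (by positivity) (by positivity),
        ENNReal.ofReal_mul (p := (A' : ℝ)) A'.2,
        ENNReal.ofReal_mul (p := (s * c * (2 * ε)) ^ (-(n : ℝ))) (by positivity),
        ENNReal.ofReal_coe_nnreal]
    _ ≤ _ := by
      refine ENNReal.ofReal_le_ofReal ?_
      -- Here the powers of `s` from the kernel and from the volume integral combine to the decay in
      -- `λ`.
      have e1 : s ^ ((n : ℝ) - 2) * s ^ (-(n : ℝ)) = 1 / ‖lam‖ := by
        rw [← Real.rpow_add hs0, hs, ← Real.rpow_mul hlam0.le,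
          show (1 / 2 : ℝ) * ((n : ℝ) - 2 + -(n : ℝ)) = -1 by ring, Real.rpow_neg_one, one_div]
      rw [mul_assoc s c (2 * ε), Real.mul_rpow hs0.le hc.le,
        Real.mul_rpow hs0.le (by positivity : 0 ≤ c * (2 * ε))]
      rw [div_eq_mul_one_div _ ‖lam‖, ← e1]
      have e2 : 0 < s ^ ((n : ℝ) - 2) * s ^ (-(n : ℝ)) := by positivity
      nlinarith

end KernelBound

/-! ### From the kernel bound to the operator bounds. -/

section GreenOperator

/-- An integral operator with kernel bounded in `L¹` in the second variable is bounded for the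
supremum norm and for the essential supremum norm. -/
lemma integral_operator_bounds {X : Type*} [TopologicalSpace X] [CompactSpace X]
    [MeasurableSpace X] [BorelSpace X] {μ : Measure X} {K : X → X → ℂ} {B : ℝ} (hB : 0 ≤ B)
    (hm : ∀ x, AEStronglyMeasurable (K x) μ)
    (hK : ∀ x, ∫⁻ y, ‖K x y‖ₑ ∂μ ≤ ENNReal.ofReal B) (f : C(X, ℂ)) :
    (∀ x, Integrable (fun y => K x y * f y) μ) ∧
      (∀ x, ‖∫ y, K x y * f y ∂μ‖ ≤ B * ‖f‖) ∧
      eLpNorm (fun x => ∫ y, K x y * f y ∂μ) ⊤ μ ≤ ENNReal.ofReal B * eLpNorm f ⊤ μ := by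
  have hfm : AEStronglyMeasurable f μ := f.continuous.aestronglyMeasurable
  have hint : ∀ x, Integrable (K x) μ := fun x =>
    ⟨hm x, (hK x).trans_lt ENNReal.ofReal_lt_top⟩
  -- An almost-everywhere bound `L` serves both norms: take the supremum or the essential supremum
  -- of `f`.
  have hbound : ∀ (L : ℝ≥0∞) (x : X), (∀ᵐ y ∂μ, ‖f y‖ₑ ≤ L) →
      ‖∫ y, K x y * f y ∂μ‖ₑ ≤ ENNReal.ofReal B * L := by
    intro L x hL
    calc ‖∫ y, K x y * f y ∂μ‖ₑ ≤ ∫⁻ y, ‖K x y * f y‖ₑ ∂μ := enorm_integral_le_lintegral_enorm _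
      _ ≤ ∫⁻ y, ‖K x y‖ₑ * L ∂μ := by
        refine lintegral_mono_ae ?_
        filter_upwards [hL] with y hy
        rw [enorm_mul]
        gcongr
      _ = (∫⁻ y, ‖K x y‖ₑ ∂μ) * L := lintegral_mul_const'' _ (hm x).enorm
      _ ≤ ENNReal.ofReal B * L := by gcongr; exact hK x
  refine ⟨fun x => ?_, fun x => ?_, ?_⟩
  · exact (hint x).mul_bdd hfm (ae_of_all _ f.norm_coe_le_norm)
  · have h := hbound (ENNReal.ofReal ‖f‖) x (ae_of_all _ fun y => by
      rw [← ofReal_norm]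
      exact ENNReal.ofReal_le_ofReal (f.norm_coe_le_norm y))
    rw [← ofReal_norm, ← ENNReal.ofReal_mul hB] at h
    exact (ENNReal.ofReal_le_ofReal_iff (by positivity)).1 h
  · rw [eLpNorm_exponent_top, eLpNorm_exponent_top]
    exact eLpNormEssSup_le_of_ae_enorm_bound
      (ae_of_all _ fun x => hbound _ x (ae_le_eLpNormEssSup (f := f)))

end GreenOperator

theorem proposition2p2 (n : ℕ) [NeZero n]
    {M : Type*} [EMetricSpace M] [CompactSpace M] [MeasurableSpace M] [BorelSpace M]
    [ChartedSpace (EuclideanHalfSpace n) M] [IsManifold (𝓡∂ n) ∞ M]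
    [RiemannianBundle (fun x : M => TangentSpace (𝓡∂ n) x)]
    [IsContMDiffRiemannianBundle (𝓡∂ n) ∞ (EuclideanSpace ℝ (Fin n))
      (fun x : M => TangentSpace (𝓡∂ n) x)]
    [IsRiemannianManifold (𝓡∂ n) M]
    {N : Type*} [EMetricSpace N]
    [ChartedSpace (EuclideanSpace ℝ (Fin n)) N] [IsManifold (𝓡 n) ∞ N]
    [RiemannianBundle (fun x : N => TangentSpace (𝓡 n) x)]
    [IsContMDiffRiemannianBundle (𝓡 n) ∞ (EuclideanSpace ℝ (Fin n))
      (fun x : N => TangentSpace (𝓡 n) x)]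
    [IsRiemannianManifold (𝓡 n) N]
    (ι : M → N) (hι : IsRiemannianExtension (n := n) ι)
    (ε : ℝ) (hε : 0 < ε) (χ : ℝ → ℝ) (hχ : IsCutoff χ)
    (ρ' : N → N → ℝ) (hρ' : IsSmoothedDistExtension ε χ ι ρ')
    (σ : M → N) (hσ : IsReflection n ε ι ρ' σ)
    (η : ℝ) (hη : 0 < η) :
    ∃ C : ℝ, 0 < C ∧ ∀ lam ∈ sector (Real.pi - η), 1 ≤ ‖lam‖ → ∀ f : C(M, ℂ),
      (∀ x : M, Integrable (fun y => greenKernel n ε χ ι ρ' σ lam x y * f y)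
        (riemannianVolume n M)) ∧
      (∀ x : M, ‖greenOp n ε χ ι ρ' σ lam f x‖ ≤ C / ‖lam‖ * ‖f‖) ∧
      eLpNorm (greenOp n ε χ ι ρ' σ lam f) ∞ (riemannianVolume n M) ≤
        ENNReal.ofReal (C / ‖lam‖) * eLpNorm f ∞ (riemannianVolume n M) := by
  obtain ⟨C, hC, hmain⟩ := exists_lintegral_radialKernel_le hι hε hχ hρ' hη
  -- One `C` for the kernel at `ι x` and one for the kernel at `σ x`.
  refine ⟨2 * C, by positivity, fun lam hlam _ f => ?_⟩
  set μ := riemannianVolume n M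
  -- The three cases of the kernel differ only in the weight `w` of the reflected term: `1`, the
  -- cut-off value, or `0`.
  have hcase : ∀ x : M, ∃ w : ℂ, ‖w‖ ≤ 1 ∧ ∀ y, greenKernel n ε χ ι ρ' σ lam x y =
      radialKernel n lam (ρ' (ι x) (ι y)) - w * radialKernel n lam (ρ' (σ x) (ι y)) := by
    intro x
    unfold greenKernel
    split_ifs
    · exact ⟨1, by simp, fun y => by rw [one_mul]⟩
    · refine ⟨_, ?_, fun y => rfl⟩
      have h := hχ.mem_Icc (rhoBdry n ι ρ' (ι x) / ε)
      rw [Complex.norm_real, Real.norm_of_nonneg h.1]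
      exact h.2
    · exact ⟨0, by simp, fun y => by rw [zero_mul, sub_zero]⟩
  refine integral_operator_bounds (K := greenKernel n ε χ ι ρ' σ lam) (by positivity)
    (fun x => ?_) (fun x => ?_) f
  · obtain ⟨w, -, hw⟩ := hcase x
    simp only [funext hw]
    exact (hmain lam hlam (ι x)).1.sub ((hmain lam hlam (σ x)).1.const_mul w)
  · obtain ⟨w, hw1, hw⟩ := hcase x
    calc ∫⁻ y, ‖greenKernel n ε χ ι ρ' σ lam x y‖ₑ ∂μ
        ≤ ∫⁻ y, (‖radialKernel n lam (ρ' (ι x) (ι y))‖ₑ +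
            ‖radialKernel n lam (ρ' (σ x) (ι y))‖ₑ) ∂μ := by
          refine lintegral_mono fun y => ?_
          rw [hw]
          refine enorm_sub_le.trans ?_
          rw [enorm_mul]
          gcongr
          refine mul_le_of_le_one_left' ?_
          rw [← ofReal_norm]
          exact ENNReal.ofReal_le_one.2 hw1
      _ = (∫⁻ y, ‖radialKernel n lam (ρ' (ι x) (ι y))‖ₑ ∂μ) +
            ∫⁻ y, ‖radialKernel n lam (ρ' (σ x) (ι y))‖ₑ ∂μ :=
          lintegral_add_left' (hmain lam hlam (ι x)).1.enorm _
      _ ≤ ENNReal.ofReal (C / ‖lam‖) + ENNReal.ofReal (C / ‖lam‖) :=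
          add_le_add (hmain lam hlam (ι x)).2 (hmain lam hlam (σ x)).2
      _ = ENNReal.ofReal (2 * C / ‖lam‖) := by
          rw [← ENNReal.ofReal_add (by positivity) (by positivity)]
          congr 1
          ring
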